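/- **Theorem (AT for Coupling to Low-Temperature Environment, AT-Env).** Units are chosen with $\hbar=1$. Let $E$ be a complex Hilbert space (the system) and $F$ a complex Hilbert space of finite dimension $M$ (the environment). For $s\in[0,1]$ let $\mathcal H(s)$ be a bounded self-adjoint operator on $E$ with a countable complete orthonormal system of eigenstates, whose ground state is non-degenerate. Let $P(s)$ be the orthogonal projection onto the ground state of $\mathcal H(s)$ and $Q(s)=I-P(s)$. Let $\bar\gamma$ be the minimum over $s\in[0,1]$ of the energy gap between the ground state and the first excited state of $\mathcal H(s)$, or any real number such that for every $s\in[0,1]$ all other eigenvalues of $\mathcal H(s)$ exceed the ground state energy by at least $\bar\gamma$. Let $\mathcal H_{env}$ be a self-adjoint operator on $F$ whose least eigenvalue is $0$, let $\epsilon\ge 0$, let $\Delta(s)$ be a bounded operator on $E\otimes F$ for each $s\in[0,1]$, and put $$\mathcal H_\epsilon(s)=\mathcal H(s)\otimes I+I\otimes\mathcal H_{env}+\epsilon\Delta(s).$$ Assume that each $\mathcal H_\epsilon(s)$, $s\in[0,1]$, is self-adjoint with a countable complete orthonormal system of eigenstates, and that $s\mapsto\mathcal H_\epsilon(s)$ is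 twice differentiable on $[0,1]$ in operator norm (one-sided at the end points), with $$\|\dot{\mathcal H}_\epsilon(s)\|\le\bar b_1,\qquad \|\ddot{\mathcal H}_\epsilon(s)\|\le\bar b_2\qquad(0\le s\le 1).$$ Suppose that $w$ is a real number with $$\|\mathcal H_{env}\|+2\epsilon\|\Delta(s)\|\le w<\bar\gamma\qquad(0\le s\le1).$$ Let $\tau>0$ be the total evolution time, and let $U_\epsilon$ be the evolution operator, that is, the solution on $[0,1]$ of $\dot U_\epsilon(s)=-i\tau\mathcal H_\epsilon(s)U_\epsilon(s)$, $U_\epsilon(0)=I$. Define $$\delta_i=\frac{\epsilon\|\Delta(i)\|}{\bar\gamma-\|\mathcal H_{env}\|-\epsilon\|\Delta(i)\|}\quad(i=0,1),$$ $$\bar\gamma_\epsilon=\begin{cases}\bar\gamma-w&\epsilon>0\\ \bar\gamma&\epsilon=0,\end{cases}\qquad \bar D=\begin{cases}1+\dfrac{2w}{\pi\bar\gamma_\epsilon}&\epsilon>0\\ 1&\epsilon=0.\end{cases}$$ Then $$\|(Q(1)\otimes I)\,U_\epsilon(1)\,(P(0)\otimes I)\|\le\frac{8\bar D^2}{\tau\bar\gamma_\epsilon^2}\left(2\bar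 b_1+\bar b_2+\frac{8(1+\bar D)\bar b_1^2}{\bar\gamma_\epsilon}\right)+\delta_0+\delta_1+\delta_0\delta_1 .$$ -/

import Mathlib

open Set
open scoped TensorProduct

namespace AdiabaticEnv

noncomputable section

section Operators

variable {V : Type*} [NormedAddCommGroup V] [InnerProductSpace ℂ V]

/-- The energies of a bounded operator `A`: its real eigenvalues. -/
def energies (A : V →L[ℂ] V) : Set ℝ :=
  {μ : ℝ | Module.End.HasEigenvalue (A : V →ₗ[ℂ] V) (μ : ℂ)}

/-- `A` has a countable complete orthonormal system of eigenstates, with real eigenvalues. -/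
def HasCountableEigenbasis (A : V →L[ℂ] V) : Prop :=
  ∃ (ι : Type) (_ : Countable ι) (b : HilbertBasis ι ℂ V),
    ∀ i, ∃ μ : ℝ, A (b i) = (μ : ℂ) • b i

/-- A Hamiltonian: a bounded self-adjoint operator with countably many eigenstates
spanning the space. (A bounded everywhere defined operator is self-adjoint if and only if it is
symmetric.) -/
structure IsHamiltonian (A : V →L[ℂ] V) : Prop where
  symmetric : (A : V →ₗ[ℂ] V).IsSymmetric
  eigenbasis : HasCountableEigenbasis A

/-- The ground state energy. -/
def groundEnergy (A : V →L[ℂ] V) : ℝ := sInf (energies A)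

/-- `A` has a non-degenerate ground state, and every other energy of `A` exceeds the ground state
energy by at least `g`. -/
structure HasGroundGap (A : V →L[ℂ] V) (g : ℝ) : Prop where
  isLeast : IsLeast (energies A) (groundEnergy A)
  nondegenerate :
    Module.finrank ℂ (Module.End.eigenspace (A : V →ₗ[ℂ] V) (groundEnergy A : ℂ)) = 1
  gap : ∀ μ ∈ energies A, μ ≠ groundEnergy A → g ≤ μ - groundEnergy A

/-- The orthogonal projection onto the ground state of `A`, that is, onto the kernel of
`A - groundEnergy A`. -/
def groundProj [CompleteSpace V] (A : V →L[ℂ] V) : V →L[ℂ] V :=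
  (A - (groundEnergy A : ℂ) • ContinuousLinearMap.id ℂ V).ker.starProjection

/-- The complementary projection `Q = I - P`. -/
def excitedProj [CompleteSpace V] (A : V →L[ℂ] V) : V →L[ℂ] V :=
  ContinuousLinearMap.id ℂ V - groundProj A

/-- The first derivative on `[0,1]` of a Hamiltonian evolution (one-sided at the end points). -/
def deriv1 (A : ℝ → V →L[ℂ] V) (s : ℝ) : V →L[ℂ] V := derivWithin A (Icc 0 1) s

/-- The second derivative on `[0,1]` of a Hamiltonian evolution. -/
def deriv2 (A : ℝ → V →L[ℂ] V) (s : ℝ) : V →L[ℂ] V := derivWithin (deriv1 A) (Icc 0 1) s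

/-- A Hamiltonian evolution on `[0,1]` to which adiabatic theorems apply: at each time a
Hamiltonian, and twice differentiable in operator norm. -/
structure IsAdiabaticEvolution (A : ℝ → V →L[ℂ] V) : Prop where
  hamiltonian : ∀ s ∈ Icc (0 : ℝ) 1, IsHamiltonian (A s)
  differentiable : DifferentiableOn ℝ A (Icc 0 1)
  differentiable_deriv : DifferentiableOn ℝ (deriv1 A) (Icc 0 1)

/-- `U` is the evolution operator of `A` with total evolution time `τ`:
`U(0) = I` and `U' = -i τ A U` on `[0,1]`. -/
structure IsEvolution (τ : ℝ) (A U : ℝ → V →L[ℂ] V) : Prop where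
  initial : U 0 = ContinuousLinearMap.id ℂ V
  schrodinger : ∀ s ∈ Icc (0 : ℝ) 1,
    HasDerivWithinAt U ((-Complex.I * (τ : ℂ)) • (A s ∘L U s)) (Icc 0 1) s

end Operators

section Composite

variable {E F : Type*} [NormedAddCommGroup E] [InnerProductSpace ℂ E]
  [NormedAddCommGroup F] [InnerProductSpace ℂ F]

/-- The Hamiltonian `H ⊗ I + I ⊗ Henv + ε Δ` of a system coupled to an environment. -/
def compositeHamiltonian (H : E →L[ℂ] E) (Henv : F →L[ℂ] F) (ε : ℝ)
    (Δ : E ⊗[ℂ] F →L[ℂ] E ⊗[ℂ] F) : E ⊗[ℂ] F →L[ℂ] E ⊗[ℂ] F :=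
  TensorProduct.mapL H (ContinuousLinearMap.id ℂ F)
    + TensorProduct.mapL (ContinuousLinearMap.id ℂ E) Henv + (ε : ℂ) • Δ

end Composite

/-- The gap `γ_ε`: it is `γ - w` for `ε > 0` and `γ` for `ε = 0`. -/
def coupledGap (ε γ w : ℝ) : ℝ :=
  open Classical in if 0 < ε then γ - w else γ

/-- The factor `D`: it is `1 + 2 w / (π γ_ε)` for `ε > 0` and `1` for `ε = 0`. -/
def widthFactor (ε γ w : ℝ) : ℝ :=
  open Classical in if 0 < ε then 1 + 2 * w / (Real.pi * coupledGap ε γ w) else 1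

/-- `ε ‖Δ‖ / (γ - ‖Henv‖ - ε ‖Δ‖)`, with the norms of `Δ` and `Henv` as arguments. -/
def endpointError (ε γ normEnv normΔ : ℝ) : ℝ :=
  ε * normΔ / (γ - normEnv - ε * normΔ)

end

end AdiabaticEnv

open AdiabaticEnv

/-! Let `D = εΔ`, let `h` be the norm of the environment Hamiltonian and `E₀` the ground energy of
the system. By Weyl's inequality the energies of the composite lie either in the low band `[E₀ -
‖D‖, E₀ + h + ‖D‖]` or above `E₀ + γ - ‖D‖`. The gap between is at least `γ - w`, and the low band
has total multiplicity `dim F`. An adiabatic theorem for the low-band projection bounds transitions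
out of the band. At both ends of the evolution the band projection is compared with `groundProj ⊗ I`
by a Davis-Kahan estimate, in which the environment commutes with `groundProj ⊗ I` and only `D`
enters the numerator; this produces `δ₀`, `δ₁`, `δ₀δ₁`.

The adiabatic theorem is Kato's argument. If `X` solves `[H, X] = P'`, the derivative of `U* (P +
(i/τ) X) U` is only `(i/τ) U* X' U`. So `U* P U` changes by `O(1/τ)`, with constants from the norms
of `X` and `X'` (`IsGappedFamily.exists_generator`, `IsGappedFamily.norm_transition_le`).

All norms come from the Sylvester equation `B W - W B = Y` in the block `(1 - P) W P`. Energies are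
measured from a point for which the band is in a ball of radius `α` and the other energies are
outside the ball of radius `β > α`; then `‖W‖ ≤ ‖Y‖ / (β - α)`, with constant one and no contour
integral (`SpectralSplit.norm_compl_mul_mul_proj_le`). Hence the factor `widthFactor` is not needed
and is inserted only at the end, using that it is at least one.

Without coupling the same theorem is applied to `H ⊗ I`, with the full gap `γ`; the environment is a
commuting summand which leaves the commutator with `X` unchanged. -/

open Filter Topology Asymptotics

/-! ### Spectral splittings and Davis-Kahan estimates in normed rings. -/

/-- `P` is a spectral idempotent of `B` on whose range `B` has norm at most `α`, while `B` is
bounded below by `β` on the range of `1 - P`, where `G` is its inverse. -/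
structure SpectralSplit {A : Type*} [NormedRing A] (B P G : A) (α β : ℝ) : Prop where
  idem : P * P = P
  comm : B * P = P * B
  left_inv : G * B = 1 - P
  right_inv : B * G = 1 - P
  mul_proj : G * P = 0
  proj_mul : P * G = 0
  norm_proj : ‖P‖ ≤ 1
  norm_compl : ‖1 - P‖ ≤ 1
  pos : 0 < β
  norm_mul_proj : ‖B * P‖ ≤ α
  norm_inv : β * ‖G‖ ≤ 1

namespace SpectralSplit

section Ring

variable {A : Type*} [NormedRing A] {B P G B₁ P₁ G₁ B₂ P₂ G₂ : A} {α β α₁ β₁ α₂ β₂ : ℝ}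

theorem map {A' : Type*} [NormedRing A'] (h : SpectralSplit B P G α β) {φ : A → A'}
    (map_one : φ 1 = 1) (map_mul : ∀ x y, φ (x * y) = φ x * φ y)
    (map_sub : ∀ x y, φ (x - y) = φ x - φ y) (norm_le : ∀ x, ‖φ x‖ ≤ ‖x‖) :
    SpectralSplit (φ B) (φ P) (φ G) α β := by
  have map_zero : φ 0 = 0 := by rw [← sub_self (0 : A), map_sub, sub_self]
  refine ⟨?_, ?_, ?_, ?_, ?_, ?_, ?_, ?_, h.pos, ?_, ?_⟩
  · rw [← map_mul, h.idem]
  · rw [← map_mul, h.comm, map_mul]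
  · rw [← map_mul, h.left_inv, map_sub, map_one]
  · rw [← map_mul, h.right_inv, map_sub, map_one]
  · rw [← map_mul, h.mul_proj, map_zero]
  · rw [← map_mul, h.proj_mul, map_zero]
  · exact (norm_le P).trans h.norm_proj
  · rw [← map_one, ← map_sub]
    exact (norm_le _).trans h.norm_compl
  · rw [← map_mul]
    exact (norm_le _).trans h.norm_mul_proj
  · exact (mul_le_mul_of_nonneg_left (norm_le G) h.pos.le).trans h.norm_inv

/-- Multiplying the block equation by the reduced inverse gives `W = G₁ (Y + W B₂ P₂)` with `β₁ ‖G₁‖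
≤ 1` and `‖B₂ P₂‖ ≤ α₂`; the term in `W` is absorbed on the left. Taking `X = 1` gives Davis-Kahan,
taking `B₁ = B₂` gives the bound for Sylvester equations. -/
theorem norm_compl_mul_mul_proj_le (h₁ : SpectralSplit B₁ P₁ G₁ α₁ β₁)
    (h₂ : SpectralSplit B₂ P₂ G₂ α₂ β₂) (X : A) :
    (β₁ - α₂) * ‖(1 - P₁) * X * P₂‖ ≤ ‖(1 - P₁) * (B₁ * X - X * B₂) * P₂‖ := by
  set W := (1 - P₁) * X * P₂ with hW
  set Y := (1 - P₁) * (B₁ * X - X * B₂) * P₂ with hY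
  have e1 : G₁ * (1 - P₁) = G₁ := by rw [mul_sub, h₁.mul_proj, mul_one, sub_zero]
  have e2 : B₂ * P₂ = P₂ * (B₂ * P₂) := by rw [h₂.comm, ← mul_assoc, h₂.idem]
  have key : W = G₁ * (Y + W * (B₂ * P₂)) := by
    calc W = (G₁ * B₁) * X * P₂ := by rw [h₁.left_inv]
      _ = G₁ * (B₁ * X - X * B₂) * P₂ + G₁ * X * (B₂ * P₂) := by noncomm_ring
      _ = (G₁ * (1 - P₁)) * (B₁ * X - X * B₂) * P₂
          + (G₁ * (1 - P₁)) * X * (P₂ * (B₂ * P₂)) := by rw [e1, ← e2]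
      _ = _ := by rw [hY, hW]; noncomm_ring
  have n1 : ‖W‖ ≤ ‖G₁‖ * (‖Y‖ + ‖W‖ * α₂) := by
    calc ‖W‖ = ‖G₁ * (Y + W * (B₂ * P₂))‖ := by rw [← key]
      _ ≤ ‖G₁‖ * (‖Y‖ + ‖W‖ * ‖B₂ * P₂‖) := by
          refine (norm_mul_le _ _).trans ?_
          gcongr
          exact (norm_add_le _ _).trans (by gcongr; exact norm_mul_le _ _)
      _ ≤ _ := by gcongr; exact h₂.norm_mul_proj
  have hα : 0 ≤ α₂ := (norm_nonneg _).trans h₂.norm_mul_proj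
  have n2 : β₁ * ‖W‖ ≤ 1 * (‖Y‖ + ‖W‖ * α₂) := by
    refine (mul_le_mul_of_nonneg_left n1 h₁.pos.le).trans ?_
    rw [← mul_assoc]
    gcongr
    exact h₁.norm_inv
  linarith

theorem norm_proj_mul_mul_compl_le (h₁ : SpectralSplit B₁ P₁ G₁ α₁ β₁)
    (h₂ : SpectralSplit B₂ P₂ G₂ α₂ β₂) (X : A) :
    (β₂ - α₁) * ‖P₁ * X * (1 - P₂)‖ ≤ ‖P₁ * (B₁ * X - X * B₂) * (1 - P₂)‖ := by
  set W := P₁ * X * (1 - P₂) with hW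
  set Y := P₁ * (B₁ * X - X * B₂) * (1 - P₂) with hY
  have e1 : (1 - P₂) * G₂ = G₂ := by rw [sub_mul, h₂.proj_mul, one_mul, sub_zero]
  have e2 : P₁ * B₁ = B₁ * P₁ * P₁ := by rw [mul_assoc, h₁.idem, h₁.comm]
  have key : W = (B₁ * P₁ * W - Y) * G₂ := by
    calc W = P₁ * X * (B₂ * G₂) := by rw [h₂.right_inv]
      _ = P₁ * B₁ * X * G₂ - P₁ * (B₁ * X - X * B₂) * G₂ := by noncomm_ring
      _ = B₁ * P₁ * P₁ * X * ((1 - P₂) * G₂)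
          - P₁ * (B₁ * X - X * B₂) * ((1 - P₂) * G₂) := by rw [e1, e2]
      _ = _ := by rw [hY, hW]; noncomm_ring
  have n1 : ‖W‖ ≤ (α₁ * ‖W‖ + ‖Y‖) * ‖G₂‖ := by
    calc ‖W‖ = ‖(B₁ * P₁ * W - Y) * G₂‖ := by rw [← key]
      _ ≤ (‖B₁ * P₁‖ * ‖W‖ + ‖Y‖) * ‖G₂‖ := by
          refine (norm_mul_le _ _).trans ?_
          gcongr
          exact (norm_sub_le _ _).trans (by gcongr; exact norm_mul_le _ _)
      _ ≤ _ := by gcongr; exact h₁.norm_mul_proj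
  have hα : 0 ≤ α₁ := (norm_nonneg _).trans h₁.norm_mul_proj
  have n2 : β₂ * ‖W‖ ≤ (α₁ * ‖W‖ + ‖Y‖) * 1 := by
    refine (mul_le_mul_of_nonneg_left n1 h₂.pos.le).trans ?_
    rw [mul_left_comm]
    gcongr
    exact h₂.norm_inv
  linarith

/-- Davis-Kahan estimate. -/
theorem norm_compl_mul_proj_le (h₁ : SpectralSplit B₁ P₁ G₁ α₁ β₁)
    (h₂ : SpectralSplit B₂ P₂ G₂ α₂ β₂) :
    (β₁ - α₂) * ‖(1 - P₁) * P₂‖ ≤ ‖B₁ - B₂‖ := by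
  have h := h₁.norm_compl_mul_mul_proj_le h₂ 1
  rw [mul_one, mul_one, one_mul] at h
  refine h.trans ?_
  calc ‖(1 - P₁) * (B₁ - B₂) * P₂‖ ≤ 1 * ‖B₁ - B₂‖ * 1 := by
        refine (norm_mul_le _ _).trans ?_
        gcongr
        · exact (norm_mul_le _ _).trans (by gcongr; exact h₁.norm_compl)
        · exact h₂.norm_proj
    _ = _ := by ring

theorem norm_proj_mul_compl_le (h₁ : SpectralSplit B₁ P₁ G₁ α₁ β₁)
    (h₂ : SpectralSplit B₂ P₂ G₂ α₂ β₂) :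
    (β₂ - α₁) * ‖P₁ * (1 - P₂)‖ ≤ ‖B₁ - B₂‖ := by
  have h := h₁.norm_proj_mul_mul_compl_le h₂ 1
  rw [mul_one, mul_one, one_mul] at h
  refine h.trans ?_
  calc ‖P₁ * (B₁ - B₂) * (1 - P₂)‖ ≤ 1 * ‖B₁ - B₂‖ * 1 := by
        refine (norm_mul_le _ _).trans ?_
        gcongr
        · exact (norm_mul_le _ _).trans (by gcongr; exact h₁.norm_proj)
        · exact h₂.norm_compl
    _ = _ := by ring

/-- The element acts as `B` on the range of `1 - P` and as the identity on the range of `P`. Thus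
`G` is expressed through `B` and `P` by one inversion in the ring, which makes it differentiable
along with them. -/
theorem exists_unit (h : SpectralSplit B P G α β) :
    ∃ u : Aˣ, (u : A) = B * (1 - P) + P ∧ ((u⁻¹ : Aˣ) : A) = G + P := by
  have e1 : (B * (1 - P) + P) * (G + P) = 1 := by
    calc (B * (1 - P) + P) * (G + P)
        = B * G - B * (P * G) + B * P - B * (P * P) + P * G + P * P := by noncomm_ring
      _ = 1 := by rw [h.proj_mul, h.idem, h.right_inv]; noncomm_ring
  have e2 : (G + P) * (B * (1 - P) + P) = 1 := by
    calc (G + P) * (B * (1 - P) + P)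
        = G * B - G * (B * P) + G * P + P * B - P * (B * P) + P * P := by noncomm_ring
      _ = G * B - G * P * B + G * P + P * B - P * P * B + P * P := by
          rw [h.comm]; noncomm_ring
      _ = 1 := by rw [h.mul_proj, h.idem, h.left_inv]; noncomm_ring
  exact ⟨⟨_, _, e1, e2⟩, rfl, rfl⟩

theorem isUnit (h : SpectralSplit B P G α β) : IsUnit (B * (1 - P) + P) := by
  obtain ⟨u, hu, -⟩ := h.exists_unit
  exact ⟨u, hu⟩

theorem inverse_mul_compl (h : SpectralSplit B P G α β) :
    Ring.inverse (B * (1 - P) + P) * (1 - P) = G := by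
  obtain ⟨u, hu, hu'⟩ := h.exists_unit
  rw [← hu, Ring.inverse_unit, hu', add_mul, mul_sub, mul_sub, h.mul_proj, h.idem]
  noncomm_ring

end Ring

end SpectralSplit

/-! ### Solving the Sylvester equation in the off-diagonal block. -/

section Sylvester

variable {A : Type*} [NormedRing A] [NormedAlgebra ℂ A] [CompleteSpace A]

/-- The inverse of `B` on the range of `1 - P`. -/
noncomputable def reducedInverse (B P : A) : A := Ring.inverse (B * (1 - P) + P) * (1 - P)

/-- The solution `W = (1 - P) * W * P` of `B * W - W * B = (1 - P) * Y * P`. -/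
noncomputable def sylvesterSolution (B P Y : A) : A :=
  Ring.inverse (1 - ContinuousLinearMap.mulLeftRight ℝ A (reducedInverse B P) (B * P))
    (reducedInverse B P * Y * P)

variable {B P G : A} {α β : ℝ}

/-- The equation is the fixed point problem `W = G Y P + G W (B P)`, and the map `W ↦ G W (B P)` has
norm at most `α / β < 1`. -/
theorem SpectralSplit.isUnit_one_sub (h : SpectralSplit B P G α β) (hαβ : α < β) :
    IsUnit (1 - ContinuousLinearMap.mulLeftRight ℝ A (reducedInverse B P) (B * P)) := by
  refine isUnit_one_sub_of_norm_lt_one ?_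
  rw [reducedInverse, h.inverse_mul_compl]
  refine (ContinuousLinearMap.opNorm_mulLeftRight_apply_apply_le ℝ A _ _).trans_lt ?_
  have h1 := h.norm_inv
  have h2 := h.norm_mul_proj
  have h3 := h.pos
  have h4 : ‖G‖ ≤ 1 / β := by rw [le_div_iff₀ h3]; linarith
  calc ‖G‖ * ‖B * P‖ ≤ 1 / β * α := by gcongr
    _ < 1 := by rw [one_div_mul_eq_div, div_lt_one h3]; exact hαβ

theorem SpectralSplit.eq_sylvesterSolution (h : SpectralSplit B P G α β) (hαβ : α < β) {W Y : A}
    (hW : (1 - P) * W * P = W) (hY : B * W - W * B = (1 - P) * Y * P) :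
    W = sylvesterSolution B P Y := by
  have hu := h.isUnit_one_sub hαβ
  have hG : reducedInverse B P = G := h.inverse_mul_compl
  rw [sylvesterSolution]
  have key : (1 - ContinuousLinearMap.mulLeftRight ℝ A (reducedInverse B P) (B * P)) W
      = reducedInverse B P * Y * P := by
    have hP : W * P = W := by rw [← hW, mul_assoc, h.idem]
    have hGQ : G * (1 - P) = G := by rw [mul_sub, h.mul_proj, mul_one, sub_zero]
    have hQ : (1 - P) * W = W := by
      have hQQ : (1 - P) * (1 - P) = 1 - P := by rw [mul_sub, mul_one, sub_mul, h.idem]; simp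
      rw [← hW, ← mul_assoc, ← mul_assoc, hQQ]
    rw [hG]
    change W - G * W * (B * P) = _
    calc W - G * W * (B * P) = (1 - P) * W - G * W * (B * P) := by rw [hQ]
      _ = G * (B * W) - G * (W * P) * B := by rw [h.comm, ← h.left_inv]; noncomm_ring
      _ = G * (B * W - W * B) := by rw [hP]; noncomm_ring
      _ = G * Y * P := by rw [hY, ← mul_assoc, ← mul_assoc, hGQ]
  rw [← key, ← mul_apply_eq_comp, Ring.inverse_mul_cancel _ hu]
  rfl

theorem SpectralSplit.sylvesterSolution_spec (h : SpectralSplit B P G α β) (hαβ : α < β) (Y : A) :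
    (1 - P) * sylvesterSolution B P Y * P = sylvesterSolution B P Y ∧
      B * sylvesterSolution B P Y - sylvesterSolution B P Y * B = (1 - P) * Y * P := by
  have hu := h.isUnit_one_sub hαβ
  have hG : reducedInverse B P = G := h.inverse_mul_compl
  set W := sylvesterSolution B P Y with hW
  have key : (1 - ContinuousLinearMap.mulLeftRight ℝ A (reducedInverse B P) (B * P)) W
      = reducedInverse B P * Y * P := by
    rw [hW, sylvesterSolution, ← mul_apply_eq_comp, Ring.mul_inverse_cancel _ hu]
    rfl
  rw [hG] at key
  replace key : W - G * W * (B * P) = G * Y * P := key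
  replace key : W = G * Y * P + G * W * (B * P) := by rw [← key]; abel
  have hPW : P * W = 0 := by
    rw [key]
    simp only [mul_add, ← mul_assoc, h.proj_mul, zero_mul, add_zero]
  have hWP : W * P = W := by
    calc W * P = (G * Y * P + G * W * (B * P)) * P := by rw [← key]
      _ = G * Y * (P * P) + G * W * (B * (P * P)) := by noncomm_ring
      _ = W := by rw [h.idem, ← key]
  constructor
  · rw [mul_assoc, hWP, sub_mul, one_mul, hPW, sub_zero]
  · have hBW : B * W = (1 - P) * Y * P + (1 - P) * W * (B * P) := by
      calc B * W = B * (G * Y * P + G * W * (B * P)) := by rw [← key]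
        _ = (B * G) * Y * P + (B * G) * W * (B * P) := by noncomm_ring
        _ = _ := by rw [h.right_inv]
    have hWB : W * B = (1 - P) * W * (B * P) := by
      rw [sub_mul, one_mul, hPW, sub_zero, h.comm, ← mul_assoc, hWP]
    rw [hBW, hWB, add_sub_cancel_right]

theorem SpectralSplit.differentiableWithinAt_sylvesterSolution {B P Y : ℝ → A} {I : Set ℝ} {s : ℝ}
    (h : SpectralSplit (B s) (P s) G α β) (hαβ : α < β)
    (hB : DifferentiableWithinAt ℝ B I s) (hP : DifferentiableWithinAt ℝ P I s)
    (hY : DifferentiableWithinAt ℝ Y I s) :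
    DifferentiableWithinAt ℝ (fun t => sylvesterSolution (B t) (P t) (Y t)) I s := by
  have hG : DifferentiableWithinAt ℝ (fun t => reducedInverse (B t) (P t)) I s := by
    have h1 : DifferentiableWithinAt ℝ (fun t => B t * (1 - P t) + P t) I s :=
      (hB.mul ((differentiableWithinAt_const _).sub hP)).add hP
    have h2 := (differentiableAt_inverse (𝕜 := ℝ) h.isUnit).comp_differentiableWithinAt s h1
    exact h2.mul ((differentiableWithinAt_const _).sub hP)
  have hK : DifferentiableWithinAt ℝ (fun t => 1 - ContinuousLinearMap.mulLeftRight ℝ A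
      (reducedInverse (B t) (P t)) (B t * P t)) I s :=
    (differentiableWithinAt_const _).sub
      ((((ContinuousLinearMap.mulLeftRight ℝ A).differentiableAt).comp_differentiableWithinAt s
        hG).clm_apply (hB.mul hP))
  have h3 := (differentiableAt_inverse (𝕜 := ℝ) (h.isUnit_one_sub hαβ)).comp_differentiableWithinAt
    s hK
  exact h3.clm_apply ((hG.mul hY).mul hP)

end Sylvester

/-! ### Differentiability of spectral projections. -/

section ProjectionDerivative

variable {A : Type*} [CStarAlgebra A]

theorem hasDerivWithinAt_sylvesterSolution (B P : A) {Y : ℝ → A} {Y' : A} {I : Set ℝ} {s : ℝ}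
    (hY : HasDerivWithinAt Y Y' I s) :
    HasDerivWithinAt (fun t => sylvesterSolution B P (Y t)) (sylvesterSolution B P Y') I s := by
  have h1 : HasDerivWithinAt (fun t => reducedInverse B P * Y t * P)
      (reducedInverse B P * Y' * P) I s := (hY.const_mul _).mul_const _
  exact (ContinuousLinearMap.hasFDerivAt _).comp_hasDerivWithinAt s h1

/-- A continuous family of idempotents commuting with a differentiable family `B`
is differentiable where it splits the spectrum of `B`. -/
theorem hasDerivWithinAt_spectralProjection {B P : ℝ → A} {b G : A} {I : Set ℝ} {s α β : ℝ}
    (hs : s ∈ I) (h : SpectralSplit (B s) (P s) G α β) (hαβ : α < β)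
    (hidem : ∀ t ∈ I, P t * P t = P t) (hcomm : ∀ t ∈ I, B t * P t = P t * B t)
    (hsa : ∀ t ∈ I, IsSelfAdjoint (P t))
    (hB : HasDerivWithinAt B b I s) (hP : ContinuousWithinAt P I s) :
    HasDerivWithinAt P (sylvesterSolution (B s) (P s) (-b)
      + star (sylvesterSolution (B s) (P s) (-b))) I s := by
  set w : ℝ → A := fun t => (1 - P s) * P t * P s with hw
  have hidems := h.idem
  have hQP : (1 - P s) * P s = 0 := by rw [sub_mul, hidems]; simp
  have hPQ : P s * (1 - P s) = 0 := by rw [mul_sub, hidems]; simp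
  have hQQ : (1 - P s) * (1 - P s) = 1 - P s := by rw [mul_sub, mul_one, hQP, sub_zero]
  -- derivative of the commutator
  have hY : HasDerivWithinAt (fun t => P t * (B t - B s) - (B t - B s) * P t)
      (P s * b - b * P s) I s := by
    -- `P` is so far only continuous, so no product rule applies; since `B t - B s` vanishes at `s`,
    -- the slope of the product is the slope of `B` multiplied by `P t`.
    have e : HasDerivWithinAt (fun t => B t - B s) b I s := hB.sub_const _
    rw [hasDerivWithinAt_iff_tendsto_slope] at e ⊢
    have hP' : Tendsto P (𝓝[I \ {s}] s) (𝓝 (P s)) :=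
      hP.tendsto.mono_left (nhdsWithin_mono _ sdiff_subset)
    refine ((hP'.mul e).sub (e.mul hP')).congr fun t => ?_
    simp only [slope_def_module, sub_self, mul_zero, zero_mul, sub_zero, mul_smul_comm, smul_mul_assoc, ← smul_sub]
  have hwT : ∀ t ∈ I, w t = sylvesterSolution (B s) (P s)
      (P t * (B t - B s) - (B t - B s) * P t) := by
    intro t ht
    refine h.eq_sylvesterSolution hαβ ?_ ?_
    · calc (1 - P s) * ((1 - P s) * P t * P s) * P s
          = ((1 - P s) * (1 - P s)) * P t * (P s * P s) := by noncomm_ring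
        _ = _ := by rw [hQQ, hidems]
    · calc B s * ((1 - P s) * P t * P s) - (1 - P s) * P t * P s * B s
          = (B s - B s * P s) * P t * P s - (1 - P s) * P t * (P s * B s) := by noncomm_ring
        _ = (B s - P s * B s) * P t * P s - (1 - P s) * P t * (B s * P s) := by rw [h.comm]
        _ = (1 - P s) * (B t * P t - P t * B t) * P s + (1 - P s) *
            (P t * (B t - B s) - (B t - B s) * P t) * P s := by noncomm_ring
        _ = _ := by rw [hcomm t ht]; noncomm_ring
  have hw' : HasDerivWithinAt w (sylvesterSolution (B s) (P s) (-b)) I s := by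
    have h1 := hasDerivWithinAt_sylvesterSolution (B s) (P s) hY
    have h2 : sylvesterSolution (B s) (P s) (P s * b - b * P s)
        = sylvesterSolution (B s) (P s) (-b) := by
      refine h.eq_sylvesterSolution hαβ (h.sylvesterSolution_spec hαβ _).1 ?_
      rw [(h.sylvesterSolution_spec hαβ _).2]
      calc (1 - P s) * (P s * b - b * P s) * P s
          = ((1 - P s) * P s) * b * P s - (1 - P s) * b * (P s * P s) := by noncomm_ring
        _ = _ := by rw [hQP, hidems]; noncomm_ring
    rw [h2] at h1
    exact h1.congr hwT (hwT s hs)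
  have hoff : HasDerivWithinAt (fun t => w t + star (w t)) _ I s := hw'.add hw'.star
  set D : ℝ → A := fun t => P t - P s - (w t + star (w t)) with hD
  have hstar : ∀ t ∈ I, star (w t) = P s * P t * (1 - P s) := by
    intro t ht
    simp only [hw, star_mul, star_sub, star_one, (hsa t ht).star_eq, (hsa s hs).star_eq, mul_assoc]
  -- The block-diagonal part of `P t - P s` is, up to signs, that of its square, because both are
  -- idempotent; hence it is of second order.
  have hDsq : ∀ t ∈ I, D t = (1 - P s) * ((P t - P s) * (P t - P s)) * (1 - P s)
      - P s * ((P t - P s) * (P t - P s)) * P s := by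
    intro t ht
    have ht' := hidem t ht
    calc D t = P t - P s - ((1 - P s) * P t * P s + P s * P t * (1 - P s)) := by
          rw [hD, ← hstar t ht]
      _ = (1 - P s) * P t * (1 - P s) + P s * P t * P s - P s := by noncomm_ring
      _ = (1 - P s) * (P t * P t - P t * P s - P s * P t + P s * P s) * (1 - P s)
            - P s * (P t * P t - P t * P s - P s * P t + P s * P s) * P s := by
          rw [ht']
          have e1 : (1 - P s) * (P t - P t * P s - P s * P t + P s * P s) * (1 - P s)
              = (1 - P s) * P t * (1 - P s) - (1 - P s) * P t * (P s * (1 - P s))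
                - ((1 - P s) * P s) * P t * (1 - P s) + (1 - P s) * P s * (P s * (1 - P s)) := by
            noncomm_ring
          have e2 : P s * (P t - P t * P s - P s * P t + P s * P s) * P s
              = P s * P t * P s - P s * P t * (P s * P s) - (P s * P s) * P t * P s
                + (P s * P s) * (P s * P s) := by noncomm_ring
          rw [e1, e2, hPQ, hQP, hidems, hidems]
          noncomm_ring
      _ = _ := by noncomm_ring
  have hδ : Tendsto (fun t => P t - P s) (𝓝[I] s) (𝓝 0) := by
    simpa using hP.tendsto.sub_const (P s)
  have hbound : ∀ t ∈ I, ‖D t‖ ≤ 2 * (‖P t - P s‖ * ‖P t - P s‖) := by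
    intro t ht
    have key : ∀ R X : A, ‖R‖ ≤ 1 → ‖R * (X * X) * R‖ ≤ ‖X‖ * ‖X‖ := by
      intro R X hR
      calc ‖R * (X * X) * R‖ ≤ (1 * (‖X‖ * ‖X‖)) * 1 := by
            refine (norm_mul_le _ _).trans ?_
            gcongr
            refine (norm_mul_le _ _).trans ?_
            gcongr
            exact norm_mul_le _ _
        _ = _ := by ring
    rw [hDsq t ht, two_mul]
    exact (norm_sub_le _ _).trans (add_le_add (key _ _ h.norm_compl) (key _ _ h.norm_proj))
  have hDo : D =o[𝓝[I] s] (fun t => P t - P s) := by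
    have h1 : D =O[𝓝[I] s] (fun t => ‖P t - P s‖ * ‖P t - P s‖) := by
      refine IsBigO.of_bound 2 ?_
      filter_upwards [self_mem_nhdsWithin] with t ht
      simpa using hbound t ht
    have h2 : (fun t => ‖P t - P s‖) =o[𝓝[I] s] (fun _ => (1 : ℝ)) := by
      rw [isLittleO_one_iff]
      simpa using hδ.norm
    have h3 := h2.mul_isBigO (isBigO_refl (fun t => ‖P t - P s‖) (𝓝[I] s))
    refine h1.trans_isLittleO (h3.trans_isBigO ?_)
    simpa using (isBigO_refl (fun t => P t - P s) (𝓝[I] s)).norm_left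
  have hδO : (fun t => P t - P s) =O[𝓝[I] s] (fun t => t - s) := by
    -- As `D` is negligible against `P t - P s`, the latter is of the order of its off-diagonal
    -- part, which is already known to be differentiable.
    have h1 := hDo.right_isBigO_sub
    refine h1.trans ?_
    have h2 := hoff.differentiableWithinAt.isBigO_sub
    refine h2.congr' ?_ EventuallyEq.rfl
    have hws : w s = 0 := by simp [hw, hQP]
    filter_upwards with t
    simp [hD, hws]
  have hDder : HasDerivWithinAt D 0 I s := by
    rw [hasDerivWithinAt_iff_isLittleO]
    have hDs : D s = 0 := by
      have := hDsq s hs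
      simpa using this
    simpa [hDs] using hDo.trans_isBigO hδO
  have := (hoff.add hDder).add_const (P s)
  rw [add_zero] at this
  refine this.congr (fun t _ => ?_) ?_ <;> simp [hD]

end ProjectionDerivative

/-! ### The generator `X` with `[B, X] = P'` and its norm bounds. -/

section AdiabaticGenerator

variable {A : Type*} [CStarAlgebra A]

/-- A self-adjoint family `B` on `[0,1]` with a continuous family of spectral projections `P`
separated from the rest of the spectrum by at least `g`. -/
structure IsGappedFamily (B P : ℝ → A) (g : ℝ) : Prop where
  split : ∀ s ∈ Icc (0 : ℝ) 1, ∃ G α β, SpectralSplit (B s) (P s) G α β ∧ g ≤ β - α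
  selfAdjoint : ∀ s ∈ Icc (0 : ℝ) 1, IsSelfAdjoint (B s)
  selfAdjoint_proj : ∀ s ∈ Icc (0 : ℝ) 1, IsSelfAdjoint (P s)
  continuousOn : ContinuousOn P (Icc 0 1)

/-- `‖a * x * c‖ ≤ ‖x‖` for contractions `a`, `c`. -/
theorem norm_mul_mul_le_of_contraction {R : Type*} [NormedRing R] {a c : R} (x : R)
    (ha : ‖a‖ ≤ 1) (hc : ‖c‖ ≤ 1) : ‖a * x * c‖ ≤ ‖x‖ := by
  calc ‖a * x * c‖ ≤ 1 * ‖x‖ * 1 := by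
        refine (norm_mul_le _ _).trans ?_
        gcongr
        exact (norm_mul_le _ _).trans (by gcongr)
    _ = _ := by ring

/-- The norm bounds for a solution `z` of `B z - z B = y`, `B y - y B = -(1 - P) b P`, and its
derivative, in terms of the derivatives `b`, `b'` of `B` and `p = y + star y` of `P`. -/
theorem SpectralSplit.norm_generator_le {B P G y z b b' y' z' : A} {α β g b₁ b₂ : ℝ}
    (h : SpectralSplit B P G α β) (hg : 0 < g) (hgap : g ≤ β - α)
    (hb : ‖b‖ ≤ b₁) (hb' : ‖b'‖ ≤ b₂)
    (hy : (1 - P) * y * P = y) (hz : (1 - P) * z * P = z)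
    (hBy : B * y - y * B = -((1 - P) * b * P)) (hBz : B * z - z * B = y)
    (hBy' : b * y + B * y' - (y' * B + y * b) = -((-(y + star y) * b + (1 - P) * b') * P
      + (1 - P) * b * (y + star y)))
    (hBz' : b * z + B * z' - (z' * B + z * b) = y')
    (hz' : (-(y + star y) * z + (1 - P) * z') * P + (1 - P) * z * (y + star y) = z') :
    ‖z‖ ≤ b₁ / g ^ 2 ∧ ‖z'‖ ≤ (b₂ + 12 * b₁ ^ 2 / g) / g ^ 2 := by
  have hb0 : 0 ≤ b₁ := (norm_nonneg _).trans hb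
  have syl : ∀ X C, ‖(1 - P) * (B * X - X * B) * P‖ ≤ C → ‖(1 - P) * X * P‖ ≤ C / g := by
    intro X C hC
    rw [le_div_iff₀ hg]
    have h1 := h.norm_compl_mul_mul_proj_le h X
    nlinarith [norm_nonneg ((1 - P) * X * P)]
  have con : ∀ X : A, ‖(1 - P) * X * P‖ ≤ ‖X‖ := fun X =>
    norm_mul_mul_le_of_contraction X h.norm_compl h.norm_proj
  have ny : ‖y‖ ≤ b₁ / g := by
    rw [← hy]
    refine syl y b₁ ((con _).trans ?_)
    rw [hBy, norm_neg]
    exact (con b).trans hb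
  have nz : ‖z‖ ≤ b₁ / g / g := by
    rw [← hz]
    refine syl z _ ((con _).trans ?_)
    rwa [hBz]
  set p := y + star y with hp
  have np : ‖p‖ ≤ 2 * (b₁ / g) := by
    refine (norm_add_le _ _).trans ?_
    rw [norm_star]
    linarith
  have mul_le : ∀ {u v : A} {r t : ℝ}, ‖u‖ ≤ r → ‖v‖ ≤ t → ‖u * v‖ ≤ r * t := by
    intro u v r t hu hv
    exact (norm_mul_le _ _).trans
      (mul_le_mul hu hv (norm_nonneg _) ((norm_nonneg _).trans hu))
  have ny' : ‖(1 - P) * y' * P‖ ≤ (b₂ + 6 * (b₁ * (b₁ / g))) / g := by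
    refine syl y' _ ((con _).trans ?_)
    -- Differentiating `[B, y] = -(1 - P) b P` gives a Sylvester equation for `y'`, whose right-hand
    -- side contains `b'` and products of two first-order terms.
    have e : B * y' - y' * B = y * b - b * y + (p * b * P - (1 - P) * b' * P - (1 - P) * b * p) := by
      have : B * y' - y' * B = (b * y + B * y' - (y' * B + y * b)) + (y * b - b * y) := by
        noncomm_ring
      rw [this, hBy']
      noncomm_ring
    rw [e]
    have n1 : ‖y * b‖ ≤ b₁ / g * b₁ := mul_le ny hb
    have n2 : ‖b * y‖ ≤ b₁ * (b₁ / g) := mul_le hb ny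
    have n3 : ‖p * b * P‖ ≤ 2 * (b₁ / g) * b₁ * 1 := mul_le (mul_le np hb) h.norm_proj
    have n4 : ‖(1 - P) * b' * P‖ ≤ b₂ := (con _).trans hb'
    have n5 : ‖(1 - P) * b * p‖ ≤ 1 * b₁ * (2 * (b₁ / g)) := mul_le (mul_le h.norm_compl hb) np
    have m1 := norm_add_le (y * b - b * y) (p * b * P - (1 - P) * b' * P - (1 - P) * b * p)
    have m2 := norm_sub_le (y * b) (b * y)
    have m3 := norm_sub_le (p * b * P - (1 - P) * b' * P) ((1 - P) * b * p)
    have m4 := norm_sub_le (p * b * P) ((1 - P) * b' * P)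
    linarith
  have nz' : ‖(1 - P) * z' * P‖
      ≤ ((b₂ + 6 * (b₁ * (b₁ / g))) / g + 2 * (b₁ * (b₁ / g / g))) / g := by
    refine syl z' _ ?_
    have e : (1 - P) * (B * z' - z' * B) * P
        = (1 - P) * y' * P + (1 - P) * (z * b - b * z) * P := by
      rw [← hBz']
      noncomm_ring
    rw [e]
    have n1 : ‖z * b‖ ≤ b₁ / g / g * b₁ := mul_le nz hb
    have n2 : ‖b * z‖ ≤ b₁ * (b₁ / g / g) := mul_le hb nz
    have m1 := norm_add_le ((1 - P) * y' * P) ((1 - P) * (z * b - b * z) * P)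
    have m2 := con (z * b - b * z)
    have m3 := norm_sub_le (z * b) (b * z)
    linarith
  refine ⟨nz.trans_eq (by field_simp), ?_⟩
  -- The derivative of `z = (1 - P) z P` leaves the block: the other two terms come from the motion
  -- of `P`. In units of `b₁² / g³` they contribute 2 each, and the block of `z'` contributes 6 + 2,
  -- which makes the constant 12.
  have e : z' = -(p * z * P) + (1 - P) * z' * P + (1 - P) * z * p := by
    nth_rewrite 1 [← hz']
    noncomm_ring
  have n1 : ‖p * z * P‖ ≤ 2 * (b₁ / g) * (b₁ / g / g) * 1 := mul_le (mul_le np nz) h.norm_proj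
  have n2 : ‖(1 - P) * z * p‖ ≤ 1 * (b₁ / g / g) * (2 * (b₁ / g)) :=
    mul_le (mul_le h.norm_compl nz) np
  have m1 := norm_add_le (-(p * z * P) + (1 - P) * z' * P) ((1 - P) * z * p)
  have m2 := norm_add_le (-(p * z * P)) ((1 - P) * z' * P)
  rw [norm_neg] at m2
  rw [← e] at m1
  have final : 2 * (b₁ / g) * (b₁ / g / g) * 1
      + ((b₂ + 6 * (b₁ * (b₁ / g))) / g + 2 * (b₁ * (b₁ / g / g))) / g
      + 1 * (b₁ / g / g) * (2 * (b₁ / g)) = (b₂ + 12 * b₁ ^ 2 / g) / g ^ 2 := by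
    field_simp
    ring
  linarith

/-- The generator `X` with `[B, X] = P'`: its norm and the norm of its derivative are controlled by
the gap and the derivatives of `B`; it commutes with self-adjoint elements commuting with `B`
and `P`. -/
theorem IsGappedFamily.exists_generator {B P b b' : ℝ → A} {g b₁ b₂ : ℝ}
    (h : IsGappedFamily B P g) (hg : 0 < g)
    (hB : ∀ s ∈ Icc (0 : ℝ) 1, HasDerivWithinAt B (b s) (Icc 0 1) s)
    (hb : ∀ s ∈ Icc (0 : ℝ) 1, HasDerivWithinAt b (b' s) (Icc 0 1) s)
    (hb₁ : ∀ s ∈ Icc (0 : ℝ) 1, ‖b s‖ ≤ b₁) (hb₂ : ∀ s ∈ Icc (0 : ℝ) 1, ‖b' s‖ ≤ b₂)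
    {N : A} (hN : IsSelfAdjoint N) (hNB : ∀ s ∈ Icc (0 : ℝ) 1, Commute N (B s))
    (hNP : ∀ s ∈ Icc (0 : ℝ) 1, Commute N (P s)) :
    ∃ p X X' : ℝ → A, ∀ s ∈ Icc (0 : ℝ) 1, HasDerivWithinAt P (p s) (Icc 0 1) s ∧
      HasDerivWithinAt X (X' s) (Icc 0 1) s ∧ (B s + N) * X s - X s * (B s + N) = p s ∧
      ‖X s‖ ≤ 2 * (b₁ / g ^ 2) ∧ ‖X' s‖ ≤ 2 * ((b₂ + 12 * b₁ ^ 2 / g) / g ^ 2) := by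
  -- `y` is the block `(1 - P) P' P` of the derivative of `P`, and `z` solves `[B, z] = y`.
  set y : ℝ → A := fun s => sylvesterSolution (B s) (P s) (-b s) with hy
  set z : ℝ → A := fun s => sylvesterSolution (B s) (P s) (y s) with hz
  have hP : ∀ s ∈ Icc (0 : ℝ) 1, HasDerivWithinAt P (y s + star (y s)) (Icc 0 1) s := by
    intro s hs
    obtain ⟨G, α, β, hG, hgap⟩ := h.split s hs
    refine hasDerivWithinAt_spectralProjection hs hG (by linarith) ?_ ?_ h.selfAdjoint_proj
      (hB s hs) (h.continuousOn s hs)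
    · intro t ht
      obtain ⟨G', α', β', hG', -⟩ := h.split t ht
      exact hG'.idem
    · intro t ht
      obtain ⟨G', α', β', hG', -⟩ := h.split t ht
      exact hG'.comm
  have hyd : ∀ s ∈ Icc (0 : ℝ) 1, DifferentiableWithinAt ℝ y (Icc 0 1) s := by
    intro s hs
    obtain ⟨G, α, β, hG, hgap⟩ := h.split s hs
    exact hG.differentiableWithinAt_sylvesterSolution (by linarith)
      (hB s hs).differentiableWithinAt (hP s hs).differentiableWithinAt
      (hb s hs).differentiableWithinAt.neg
  have hzd : ∀ s ∈ Icc (0 : ℝ) 1, DifferentiableWithinAt ℝ z (Icc 0 1) s := by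
    intro s hs
    obtain ⟨G, α, β, hG, hgap⟩ := h.split s hs
    exact hG.differentiableWithinAt_sylvesterSolution (by linarith)
      (hB s hs).differentiableWithinAt (hP s hs).differentiableWithinAt (hyd s hs)
  have hys : ∀ s ∈ Icc (0 : ℝ) 1, (1 - P s) * y s * P s = y s ∧
      B s * y s - y s * B s = -((1 - P s) * b s * P s) := by
    intro s hs
    obtain ⟨G, α, β, hG, hgap⟩ := h.split s hs
    have := hG.sylvesterSolution_spec (by linarith) (-b s)
    refine ⟨this.1, this.2.trans (by noncomm_ring)⟩
  have hzs : ∀ s ∈ Icc (0 : ℝ) 1, (1 - P s) * z s * P s = z s ∧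
      B s * z s - z s * B s = y s := by
    intro s hs
    obtain ⟨G, α, β, hG, hgap⟩ := h.split s hs
    have := hG.sylvesterSolution_spec (by linarith) (y s)
    exact ⟨this.1, this.2.trans (hys s hs).1⟩
  have uniq : ∀ {f k : ℝ → A} {f' k' : A} {s : ℝ}, s ∈ Icc (0 : ℝ) 1 →
      HasDerivWithinAt f f' (Icc 0 1) s → HasDerivWithinAt k k' (Icc 0 1) s →
      (∀ t ∈ Icc (0 : ℝ) 1, f t = k t) → f' = k' := by
    intro f k f' k' s hs hf hk hfk
    exact (uniqueDiffOn_Icc_zero_one s hs).eq_deriv _ hf (hk.congr hfk (hfk s hs))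
  -- The minus sign is due to `[B, star z] = -star [B, z] = -star y`, so that `[B, z - star z] = y +
  -- star y`.
  refine ⟨fun s => y s + star (y s), fun s => z s - star (z s),
    fun s => derivWithin z (Icc 0 1) s - star (derivWithin z (Icc 0 1) s), fun s hs => ?_⟩
  obtain ⟨G, α, β, hG, hgap⟩ := h.split s hs
  have dP := hP s hs
  have dy := (hyd s hs).hasDerivWithinAt
  have dz := (hzd s hs).hasDerivWithinAt
  have dB := hB s hs
  have db := hb s hs
  set y' := derivWithin y (Icc 0 1) s
  set z' := derivWithin z (Icc 0 1) s
  have dQ := dP.const_sub (1 : A)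
  have bounds := hG.norm_generator_le (y := y s) (z := z s) (b' := b' s) (y' := y') (z' := z') hg
    hgap (hb₁ s hs) (hb₂ s hs) (hys s hs).1 (hzs s hs).1
    (hys s hs).2 (hzs s hs).2
    (uniq hs ((dB.mul dy).sub (dy.mul dB)) ((dQ.mul db).mul dP).neg fun t ht => (hys t ht).2)
    (uniq hs ((dB.mul dz).sub (dz.mul dB)) dy fun t ht => (hzs t ht).2)
    (uniq hs ((dQ.mul dz).mul dP) dz fun t ht => (hzs t ht).1)
  refine ⟨dP, dz.sub dz.star, ?_, ?_, ?_⟩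
  · have hBs := (h.selfAdjoint s hs).star_eq
    have e1 : B s * star (z s) - star (z s) * B s = -star (y s) := by
      rw [← (hzs s hs).2, star_sub, star_mul, star_mul, hBs]
      noncomm_ring
    have hNp : N * (y s + star (y s)) = (y s + star (y s)) * N :=
      uniq hs (dP.const_mul N) (dP.mul_const N) fun t ht => (hNP t ht).eq
    have hNP' := (hNP s hs).eq
    have hNy : N * y s = y s * N := by
      have hPs := (h.selfAdjoint_proj s hs).star_eq
      have hQP : (1 - P s) * P s = 0 := by rw [sub_mul, hG.idem]; simp
      have e2 : (1 - P s) * (y s + star (y s)) * P s = y s := by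
        have e3 : star (y s) = P s * star (y s) * (1 - P s) := by
          nth_rewrite 1 [← (hys s hs).1]
          simp only [star_mul, star_sub, star_one, hPs, mul_assoc]
        have e4 : (1 - P s) * star (y s) = 0 := by
          rw [e3, ← mul_assoc, ← mul_assoc, hQP, zero_mul, zero_mul]
        rw [mul_add, e4, add_zero, (hys s hs).1]
      have c1 : Commute N ((1 - P s) * (y s + star (y s)) * P s) :=
        (((Commute.one_right N).sub_right (hNP s hs)).mul_right hNp).mul_right (hNP s hs)
      rw [e2] at c1
      exact c1.eq
    -- The commutator of `N` and `z` lies in the block `(1 - P) · P` and solves the homogeneous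
    -- Sylvester equation, so it vanishes.
    have hNz : N * z s = z s * N := by
      set W := N * z s - z s * N with hW
      have w1 : (1 - P s) * W * P s = W := by
        calc (1 - P s) * W * P s = N * ((1 - P s) * z s * P s) - ((1 - P s) * z s * P s) * N := by
              have : (1 - P s) * N = N * (1 - P s) := by rw [sub_mul, mul_sub, hNP']; simp
              calc (1 - P s) * W * P s
                  = ((1 - P s) * N) * z s * P s - (1 - P s) * z s * (N * P s) := by
                    rw [hW]; noncomm_ring
                _ = _ := by rw [this, hNP']; noncomm_ring
          _ = W := by rw [(hzs s hs).1]
      have w2 : B s * W - W * B s = 0 := by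
        have := (hNB s hs).eq
        calc B s * W - W * B s
            = (B s * N) * z s - B s * z s * N - N * z s * B s + z s * (N * B s) := by
              rw [hW]; noncomm_ring
          _ = N * (B s * z s - z s * B s) - (B s * z s - z s * B s) * N := by
              rw [← this]
              have e : z s * (N * B s) = z s * (B s * N) := by rw [this]
              rw [e]
              noncomm_ring
          _ = 0 := by rw [(hzs s hs).2, hNy, sub_self]
      have w3 := hG.norm_compl_mul_mul_proj_le hG W
      rw [w1, w2, mul_zero, zero_mul, norm_zero] at w3
      have : ‖W‖ ≤ 0 := by
        by_contra hc
        nlinarith [norm_nonneg W]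
      exact sub_eq_zero.1 (norm_le_zero_iff.1 this)
    have hNz' : N * star (z s) = star (z s) * N := by
      have := congrArg star hNz
      rw [star_mul, star_mul, hN.star_eq] at this
      exact this.symm
    calc (B s + N) * (z s - star (z s)) - (z s - star (z s)) * (B s + N)
        = (B s * z s - z s * B s) - (B s * star (z s) - star (z s) * B s)
          + (N * z s - z s * N) - (N * star (z s) - star (z s) * N) := by noncomm_ring
      _ = _ := by rw [hNz, hNz', e1, (hzs s hs).2]; noncomm_ring
  · refine (norm_sub_le _ _).trans ?_
    rw [norm_star]
    linarith [bounds.1]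
  · refine (norm_sub_le _ _).trans ?_
    rw [norm_star]
    linarith [bounds.2]

end AdiabaticGenerator

/-! ### Unitarity of the evolution and the adiabatic theorem for gapped families. -/

section Evolution

variable {A : Type*} [CStarAlgebra A]

theorem star_evolution {τ : ℝ} {H U : A} (hH : IsSelfAdjoint H) :
    star ((-Complex.I * (τ : ℂ)) • (H * U)) = (Complex.I * (τ : ℂ)) • (star U * H) := by
  rw [star_smul, star_mul (R := A), hH.star_eq]
  simp

theorem evolution_star_mul_self {τ : ℝ} {H U : ℝ → A}
    (hH : ∀ s ∈ Icc (0 : ℝ) 1, IsSelfAdjoint (H s)) (hU0 : U 0 = 1)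
    (hU : ∀ s ∈ Icc (0 : ℝ) 1,
      HasDerivWithinAt U ((-Complex.I * (τ : ℂ)) • (H s * U s)) (Icc 0 1) s) :
    ∀ s ∈ Icc (0 : ℝ) 1, star (U s) * U s = 1 := by
  intro s hs
  have hd : ∀ t ∈ Icc (0 : ℝ) 1,
      HasDerivWithinAt (fun r => star (U r) * U r) 0 (Icc 0 1) t := by
    intro t ht
    have h1 := (hU t ht).star
    rw [star_evolution (hH t ht)] at h1
    refine (h1.mul (hU t ht)).congr_deriv ?_
    rw [smul_mul_assoc, mul_smul_comm, mul_assoc, ← add_smul]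
    simp
  have := (convex_Icc (0 : ℝ) 1).norm_image_sub_le_of_norm_hasDerivWithin_le (C := 0) hd
    (by simp) (left_mem_Icc.2 zero_le_one) hs
  rw [zero_mul, norm_le_zero_iff, sub_eq_zero] at this
  rw [this, hU0]
  simp

/-- An isometry in infinite dimension need not be onto. The defect `U U* - 1` satisfies the linear
equation `f' = -iτ [H, f]` with `f 0 = 0`, and Grönwall's inequality makes it zero. -/
theorem evolution_self_mul_star {τ : ℝ} {H U : ℝ → A}
    (hH : ∀ s ∈ Icc (0 : ℝ) 1, IsSelfAdjoint (H s)) (hHc : ContinuousOn H (Icc 0 1))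
    (hU0 : U 0 = 1)
    (hU : ∀ s ∈ Icc (0 : ℝ) 1,
      HasDerivWithinAt U ((-Complex.I * (τ : ℂ)) • (H s * U s)) (Icc 0 1) s) :
    ∀ s ∈ Icc (0 : ℝ) 1, U s * star (U s) = 1 := by
  obtain ⟨C, hC⟩ := isCompact_Icc.exists_bound_of_continuousOn hHc
  set f : ℝ → A := fun s => U s * star (U s) - 1 with hf
  have hd : ∀ t ∈ Icc (0 : ℝ) 1,
      HasDerivWithinAt f ((-Complex.I * (τ : ℂ)) • (H t * f t - f t * H t)) (Icc 0 1) t := by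
    intro t ht
    have h1 := (hU t ht).star
    rw [star_evolution (hH t ht)] at h1
    refine (((hU t ht).mul h1).sub_const 1).congr_deriv ?_
    have e : H t * f t - f t * H t = H t * U t * star (U t) - U t * (star (U t) * H t) := by
      rw [hf]
      noncomm_ring
    rw [e, smul_mul_assoc, mul_smul_comm, smul_sub, sub_eq_add_neg, ← neg_smul, neg_mul, neg_neg]
  have hz := eq_zero_of_abs_deriv_le_mul_abs_self_of_eq_zero_right (f := f)
    (f' := fun t => (-Complex.I * (τ : ℂ)) • (H t * f t - f t * H t)) (K := |τ| * (2 * C))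
    (a := 0) (b := 1)
    (fun t ht => (hd t ht).continuousWithinAt)
    (fun t ht => (hd t ⟨ht.1, ht.2.le⟩).mono_of_mem_nhdsWithin (Icc_mem_nhdsGE_of_mem ht))
    (by simp [hf, hU0])
    (by
      intro t ht
      have hCt := hC t ⟨ht.1, ht.2.le⟩
      rw [norm_smul]
      have e : ‖-Complex.I * (τ : ℂ)‖ = |τ| := by simp
      rw [e, mul_assoc]
      gcongr
      have n1 : ‖H t * f t‖ ≤ C * ‖f t‖ := (norm_mul_le _ _).trans (by gcongr)
      have n2 : ‖f t * H t‖ ≤ ‖f t‖ * C := (norm_mul_le _ _).trans (by gcongr)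
      have := norm_sub_le (H t * f t) (f t * H t)
      linarith)
  intro s hs
  exact sub_eq_zero.1 (hz s hs)

theorem norm_le_one_of_star_mul_self {U : A} (h : star U * U = 1) : ‖U‖ ≤ 1 := by
  have h1 : ‖U‖ * ‖U‖ = ‖(1 : A)‖ := by rw [← CStarRing.norm_star_mul_self, h]
  have h2 : ‖(1 : A)‖ ≤ 1 := by
    nontriviality A
    exact (CStarRing.norm_one).le
  nlinarith [norm_nonneg U]

/-- The adiabatic theorem for a gapped family. -/
theorem IsGappedFamily.norm_transition_le {B P b b' U : ℝ → A} {g b₁ b₂ τ : ℝ}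
    (h : IsGappedFamily B P g) (hg : 0 < g) (hτ : 0 < τ)
    (hB : ∀ s ∈ Icc (0 : ℝ) 1, HasDerivWithinAt B (b s) (Icc 0 1) s)
    (hb : ∀ s ∈ Icc (0 : ℝ) 1, HasDerivWithinAt b (b' s) (Icc 0 1) s)
    (hb₁ : ∀ s ∈ Icc (0 : ℝ) 1, ‖b s‖ ≤ b₁) (hb₂ : ∀ s ∈ Icc (0 : ℝ) 1, ‖b' s‖ ≤ b₂)
    {N : A} (hN : IsSelfAdjoint N) (hNB : ∀ s ∈ Icc (0 : ℝ) 1, Commute N (B s))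
    (hNP : ∀ s ∈ Icc (0 : ℝ) 1, Commute N (P s)) (hU0 : U 0 = 1)
    (hU : ∀ s ∈ Icc (0 : ℝ) 1,
      HasDerivWithinAt U ((-Complex.I * (τ : ℂ)) • ((B s + N) * U s)) (Icc 0 1) s) :
    ‖(1 - P 1) * U 1 * P 0‖ ≤ (4 * b₁ + 2 * b₂ + 24 * b₁ ^ 2 / g) / (τ * g ^ 2) := by
  obtain ⟨p, X, X', hX⟩ := h.exists_generator hg hB hb hb₁ hb₂ hN hNB hNP
  have hH : ∀ s ∈ Icc (0 : ℝ) 1, IsSelfAdjoint (B s + N) := fun s hs => (h.selfAdjoint s hs).add hN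
  have hHc : ContinuousOn (fun s => B s + N) (Icc 0 1) :=
    ContinuousOn.add (fun s hs => (hB s hs).continuousWithinAt) continuousOn_const
  have hUU := evolution_star_mul_self hH hU0 hU
  have hUU' := evolution_self_mul_star hH hHc hU0 hU
  have hUn : ∀ s ∈ Icc (0 : ℝ) 1, ‖U s‖ ≤ 1 := fun s hs => norm_le_one_of_star_mul_self (hUU s hs)
  have m0 : (0 : ℝ) ∈ Icc (0 : ℝ) 1 := left_mem_Icc.2 zero_le_one
  have m1 : (1 : ℝ) ∈ Icc (0 : ℝ) 1 := right_mem_Icc.2 zero_le_one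
  set c : ℂ := Complex.I / (τ : ℂ) with hc
  have hτ' : (τ : ℂ) ≠ 0 := by exact_mod_cast hτ.ne'
  have hcn : ‖c‖ = 1 / τ := by simp [hc, abs_of_pos hτ]
  have hcc : (Complex.I * (τ : ℂ)) * c = -1 := by
    rw [hc]
    field_simp
    simp
  -- With `c = i / τ` the commutator term from `c X` is `iτ c [H, X] = -P'` and cancels `P'`, while
  -- `[H, P] = 0`; only `c X'` survives in the derivative.
  set Φ : ℝ → A := fun s => star (U s) * (P s + c • X s) * U s with hΦ
  have hd : ∀ s ∈ Icc (0 : ℝ) 1,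
      HasDerivWithinAt Φ (star (U s) * (c • X' s) * U s) (Icc 0 1) s := by
    intro s hs
    obtain ⟨dP, dX, hcomm, -, -⟩ := hX s hs
    have h1 := (hU s hs).star
    rw [star_evolution (hH s hs)] at h1
    refine ((h1.mul (dP.add (dX.const_smul c))).mul (hU s hs)).congr_deriv ?_
    have hPc : (B s + N) * P s = P s * (B s + N) := by
      obtain ⟨G, α, β, hG, -⟩ := h.split s hs
      rw [add_mul, mul_add, hG.comm, (hNP s hs).eq]
    set K := B s + N
    set w : ℂ := Complex.I * (τ : ℂ) with hw
    rw [neg_mul, ← hcomm]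
    calc (w • (star (U s) * K) * (P s + c • X s)
          + star (U s) * (K * X s - X s * K + c • X' s)) * U s
          + star (U s) * (P s + c • X s) * (-w) • (K * U s)
        = w • (star (U s) * (K * P s - P s * K) * U s)
          + (w * c + 1) • (star (U s) * (K * X s - X s * K) * U s)
          + star (U s) * (c • X' s) * U s := by
          simp only [mul_add, add_mul, mul_sub, sub_mul, smul_mul_assoc, mul_smul_comm, mul_assoc]
          module
      _ = _ := by rw [hPc, hcc]; simp
  have hΦ' : ∀ s ∈ Icc (0 : ℝ) 1, ‖star (U s) * (c • X' s) * U s‖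
      ≤ 1 / τ * (2 * ((b₂ + 12 * b₁ ^ 2 / g) / g ^ 2)) := by
    intro s hs
    refine (norm_mul_mul_le_of_contraction _ (by rw [norm_star]; exact hUn s hs)
      (hUn s hs)).trans ?_
    rw [norm_smul, hcn]
    gcongr
    exact (hX s hs).2.2.2.2
  have hdiff := (convex_Icc (0 : ℝ) 1).norm_image_sub_le_of_norm_hasDerivWithin_le hd hΦ' m0 m1
  have hXn : ∀ s ∈ Icc (0 : ℝ) 1, ‖star (U s) * (c • X s) * U s‖
      ≤ 1 / τ * (2 * (b₁ / g ^ 2)) := by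
    intro s hs
    refine (norm_mul_mul_le_of_contraction _ (by rw [norm_star]; exact hUn s hs)
      (hUn s hs)).trans ?_
    rw [norm_smul, hcn]
    gcongr
    exact (hX s hs).2.2.2.1
  set T := star (U 1) * P 1 * U 1 - P 0 with hT
  have hTn : ‖T‖ ≤ (4 * b₁ + 2 * b₂ + 24 * b₁ ^ 2 / g) / (τ * g ^ 2) := by
    have e : T = (Φ 1 - Φ 0) - star (U 1) * (c • X 1) * U 1
        + star (U 0) * (c • X 0) * U 0 := by
      have e0 : P 0 = star (U 0) * P 0 * U 0 := by rw [hU0]; simp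
      rw [hT, e0, hΦ]
      noncomm_ring
    have n1 := norm_add_le ((Φ 1 - Φ 0) - star (U 1) * (c • X 1) * U 1)
      (star (U 0) * (c • X 0) * U 0)
    have n2 := norm_sub_le (Φ 1 - Φ 0) (star (U 1) * (c • X 1) * U 1)
    rw [← e] at n1
    have n3 := hXn 0 m0
    have n4 := hXn 1 m1
    rw [sub_zero, norm_one, mul_one] at hdiff
    have final : 1 / τ * (2 * ((b₂ + 12 * b₁ ^ 2 / g) / g ^ 2)) + 1 / τ * (2 * (b₁ / g ^ 2))
        + 1 / τ * (2 * (b₁ / g ^ 2)) = (4 * b₁ + 2 * b₂ + 24 * b₁ ^ 2 / g) / (τ * g ^ 2) := by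
      field_simp
      ring
    linarith
  obtain ⟨G, α, β, hG, -⟩ := h.split 0 m0
  have key : (1 - P 1) * U 1 * P 0 = -(U 1 * T * P 0) := by
    calc (1 - P 1) * U 1 * P 0 = U 1 * P 0 - (U 1 * star (U 1)) * P 1 * U 1 * P 0 := by
          rw [hUU' 1 m1]
          noncomm_ring
      _ = U 1 * (P 0 * P 0) - (U 1 * star (U 1)) * P 1 * U 1 * P 0 := by rw [hG.idem]
      _ = _ := by rw [hT]; noncomm_ring
  rw [key, norm_neg]
  exact (norm_mul_mul_le_of_contraction _ (hUn 1 m1) hG.norm_proj).trans hTn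

end Evolution

/-! ### Diagonal operators and spectral projections from an eigenbasis. -/

section Diagonal

variable {V : Type*} [NormedAddCommGroup V] [InnerProductSpace ℂ V] {ι : Type*}

/-- `T` multiplies the coordinates in the Hilbert basis `b` by `f`. -/
def IsDiagonal (b : HilbertBasis ι ℂ V) (f : ι → ℂ) (T : V →L[ℂ] V) : Prop :=
  ∀ v i, b.repr (T v) i = f i * b.repr v i

namespace IsDiagonal

variable {b : HilbertBasis ι ℂ V} {f g : ι → ℂ} {S T : V →L[ℂ] V}

theorem norm_le_aux {C : ℝ} (hC : 0 ≤ C) {x y : lp (fun _ : ι => ℂ) 2} (h : ∀ i, ‖y i‖ ≤ C * ‖x i‖) :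
    ‖y‖ ≤ C * ‖x‖ := by
  have h2 : (0 : ℝ) < (2 : ENNReal).toReal := by norm_num
  refine lp.norm_le_of_tsum_le h2 (by positivity) ?_
  rw [Real.mul_rpow hC (norm_nonneg _), lp.norm_rpow_eq_tsum h2, ← tsum_mul_left]
  refine Summable.tsum_le_tsum (fun i => ?_) ((lp.memℓp y).summable h2)
    (((lp.memℓp x).summable h2).mul_left _)
  rw [← Real.mul_rpow hC (norm_nonneg _)]
  exact Real.rpow_le_rpow (norm_nonneg _) (h i) h2.le

theorem exists_of_bounded (b : HilbertBasis ι ℂ V) {f : ι → ℂ} {C : ℝ} (hC : 0 ≤ C)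
    (hf : ∀ i, ‖f i‖ ≤ C) : ∃ T : V →L[ℂ] V, IsDiagonal b f T := by
  have hmem : ∀ x : lp (fun _ : ι => ℂ) 2, Memℓp (fun i => f i * x i) 2 := by
    intro x
    refine ((lp.memℓp x).const_smul (C : ℂ)).mono' fun i => ?_
    rw [Pi.smul_apply, norm_smul, norm_mul, Complex.norm_real, Real.norm_of_nonneg hC]
    exact mul_le_mul_of_nonneg_right (hf i) (norm_nonneg _)
  let L : V →ₗ[ℂ] V :=
    { toFun := fun v => b.repr.symm ⟨fun i => f i * b.repr v i, hmem (b.repr v)⟩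
      map_add' := by
        intro v w
        apply b.repr.injective
        ext i
        simp only [map_add, LinearIsometryEquiv.apply_symm_apply, lp.coeFn_add, Pi.add_apply,
          mul_add]
      map_smul' := by
        intro c v
        apply b.repr.injective
        ext i
        simp only [map_smul, LinearIsometryEquiv.apply_symm_apply, lp.coeFn_smul, Pi.smul_apply,
          smul_eq_mul, RingHom.id_apply]
        ring }
  have hL : ∀ v i, b.repr (L v) i = f i * b.repr v i := by
    intro v i
    change b.repr (b.repr.symm ⟨fun i => f i * b.repr v i, hmem (b.repr v)⟩) i = _
    rw [LinearIsometryEquiv.apply_symm_apply]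
  refine ⟨L.mkContinuous C fun v => ?_, hL⟩
  rw [← b.repr.norm_map, ← b.repr.norm_map v]
  refine norm_le_aux hC fun i => ?_
  rw [hL, norm_mul]
  exact mul_le_mul_of_nonneg_right (hf i) (norm_nonneg _)

theorem ext (hS : IsDiagonal b f S) (hT : IsDiagonal b f T) : S = T := by
  ext v
  apply b.repr.injective
  ext1
  funext i
  rw [hS, hT]

theorem norm_le {C : ℝ} (hT : IsDiagonal b f T) (hC : 0 ≤ C) (hf : ∀ i, ‖f i‖ ≤ C) : ‖T‖ ≤ C := by
  refine T.opNorm_le_bound hC fun v => ?_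
  rw [← b.repr.norm_map, ← b.repr.norm_map v]
  refine norm_le_aux hC fun i => ?_
  rw [hT, norm_mul]
  gcongr
  exact hf i

theorem mul (hS : IsDiagonal b f S) (hT : IsDiagonal b g T) :
    IsDiagonal b (fun i => f i * g i) (S * T) := by
  intro v i
  change b.repr (S (T v)) i = _
  rw [hS, hT, mul_assoc]

theorem sub (hS : IsDiagonal b f S) (hT : IsDiagonal b g T) :
    IsDiagonal b (fun i => f i - g i) (S - T) := by
  intro v i
  change b.repr (S v - T v) i = _
  rw [map_sub, lp.coeFn_sub, Pi.sub_apply, hS, hT, sub_mul]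

theorem smul (hS : IsDiagonal b f S) (c : ℂ) : IsDiagonal b (fun i => c * f i) (c • S) := by
  intro v i
  change b.repr (c • S v) i = _
  rw [map_smul, lp.coeFn_smul, Pi.smul_apply, hS, smul_eq_mul, mul_assoc]

theorem one : IsDiagonal b (fun _ => 1) (1 : V →L[ℂ] V) := by
  intro v i
  simp

theorem zero : IsDiagonal b (fun _ => 0) (0 : V →L[ℂ] V) := by
  intro v i
  simp

theorem congr (hS : IsDiagonal b f S) (h : ∀ i, f i = g i) : IsDiagonal b g S := by
  rwa [← funext h]

theorem isSelfAdjoint [CompleteSpace V] {f : ι → ℝ} (hS : IsDiagonal b (fun i => (f i : ℂ)) S) :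
    IsSelfAdjoint S := by
  rw [ContinuousLinearMap.isSelfAdjoint_iff_isSymmetric]
  intro v w
  change inner ℂ (S v) w = inner ℂ v (S w)
  rw [← b.repr.inner_map_map, ← b.repr.inner_map_map v, lp.inner_eq_tsum, lp.inner_eq_tsum]
  congr 1
  ext i
  rw [hS, hS]
  simp
  ring

theorem of_eigenbasis {A : V →L[ℂ] V} (hA : (A : V →ₗ[ℂ] V).IsSymmetric) {ev : ι → ℝ}
    (h : ∀ i, A (b i) = (ev i : ℂ) • b i) : IsDiagonal b (fun i => (ev i : ℂ)) A := by
  intro v i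
  rw [b.repr_apply_apply, b.repr_apply_apply]
  have h1 : inner ℂ (A (b i)) v = inner ℂ (b i) (A v) := hA (b i) v
  rw [← h1, h, inner_smul_left]
  simp

end IsDiagonal

/-- `P S` is the spectral projection of `A` for the energies in `S`. -/
structure IsSpectralMeasure [CompleteSpace V] (A : V →L[ℂ] V) (P : Set ℝ → V →L[ℂ] V) : Prop where
  selfAdjoint : ∀ S, IsSelfAdjoint (P S)
  empty : P ∅ = 0
  univ : P univ = 1
  mul : ∀ S T, P S * P T = P (S ∩ T)
  congr : ∀ S T, (∀ μ ∈ energies A, μ ∈ S ↔ μ ∈ T) → P S = P T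
  split : ∀ (S : Set ℝ) (c α β : ℝ), 0 ≤ α → 0 < β →
    (∀ μ ∈ energies A, μ ∈ S → |μ - c| ≤ α) → (∀ μ ∈ energies A, μ ∉ S → β ≤ |μ - c|) →
    ∃ G, SpectralSplit (A - (c : ℂ) • 1) (P S) G α β
  singleton : ∀ μ : ℝ, P {μ} = (A - (μ : ℂ) • ContinuousLinearMap.id ℂ V).ker.starProjection

/-- In an eigenbasis `P S` multiplies coordinates by the indicator of `ev i ∈ S` and `G` by `(ev i -
c)⁻¹` off `S`. Algebraic identities are checked coordinatewise, and operator norms are bounded by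
bounds on the coefficients. -/
theorem AdiabaticEnv.IsHamiltonian.exists_spectralMeasure [CompleteSpace V] {A : V →L[ℂ] V}
    (hA : IsHamiltonian A) : ∃ P : Set ℝ → V →L[ℂ] V, IsSpectralMeasure A P := by
  classical
  obtain ⟨ι, -, b, hb⟩ := hA.eigenbasis
  choose ev hev using hb
  have hen : ∀ i, ev i ∈ energies A := by
    intro i
    refine Module.End.hasEigenvalue_of_hasEigenvector (x := b i)
      ⟨Module.End.mem_eigenspace_iff.2 (hev i), ?_⟩
    exact b.orthonormal.ne_zero i
  have hAd : IsDiagonal b (fun i => (ev i : ℂ)) A := IsDiagonal.of_eigenbasis hA.symmetric hev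
  have hex : ∀ S : Set ℝ, ∃ T : V →L[ℂ] V,
      IsDiagonal b (fun i => ((if ev i ∈ S then 1 else 0 : ℝ) : ℂ)) T := by
    intro S
    refine IsDiagonal.exists_of_bounded b zero_le_one fun i => ?_
    split_ifs <;> simp
  choose P hP using hex
  have hAc : ∀ c : ℝ, IsDiagonal b (fun i => ((ev i - c : ℝ) : ℂ)) (A - (c : ℂ) • 1) := fun c =>
    (hAd.sub (IsDiagonal.one.smul (c : ℂ))).congr fun i => by push_cast; ring
  have hQ : ∀ S, IsDiagonal b (fun i => ((if ev i ∈ S then 0 else 1 : ℝ) : ℂ)) (1 - P S) := fun S =>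
    (IsDiagonal.one.sub (hP S)).congr fun i => by split_ifs <;> simp
  refine ⟨P, fun S => (hP S).isSelfAdjoint, ?_, ?_, ?_, ?_, ?_, ?_⟩
  · exact (hP ∅).ext (IsDiagonal.zero.congr fun i => by simp)
  · exact (hP univ).ext (IsDiagonal.one.congr fun i => by simp)
  · intro S T
    refine ((hP S).mul (hP T)).ext ((hP (S ∩ T)).congr fun i => ?_)
    by_cases h1 : ev i ∈ S <;> by_cases h2 : ev i ∈ T <;> simp [h1, h2]
  · intro S T hST
    refine (hP S).ext ((hP T).congr fun i => ?_)
    simp [hST (ev i) (hen i)]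
  · intro S c α β hα hβ h1 h2
    have hGb : ∀ i, ‖((if ev i ∈ S then 0 else (ev i - c)⁻¹ : ℝ) : ℂ)‖ ≤ β⁻¹ := by
      intro i
      split_ifs with h
      · simp [hβ.le]
      · rw [Complex.norm_real, Real.norm_eq_abs, abs_inv]
        exact inv_anti₀ hβ (h2 _ (hen i) h)
    obtain ⟨G, hG⟩ := IsDiagonal.exists_of_bounded b (inv_nonneg.2 hβ.le) hGb
    have hne : ∀ i, ev i ∉ S → ((ev i : ℂ) - (c : ℂ)) ≠ 0 := by
      intro i hi h0
      have h3 := h2 _ (hen i) hi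
      have h4 : ev i - c = 0 := by exact_mod_cast h0
      rw [h4, abs_zero] at h3
      linarith
    refine ⟨G, ⟨?_, ?_, ?_, ?_, ?_, ?_, ?_, ?_, hβ, ?_, ?_⟩⟩
    · refine ((hP S).mul (hP S)).ext ((hP S).congr fun i => ?_)
      split_ifs <;> simp
    · refine ((hAc c).mul (hP S)).ext (((hP S).mul (hAc c)).congr fun i => ?_)
      ring
    · refine (hG.mul (hAc c)).ext ((hQ S).congr fun i => ?_)
      split_ifs with h
      · simp
      · push_cast
        rw [inv_mul_cancel₀ (hne i h)]
    · refine ((hAc c).mul hG).ext ((hQ S).congr fun i => ?_)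
      split_ifs with h
      · simp
      · push_cast
        rw [mul_inv_cancel₀ (hne i h)]
    · refine (hG.mul (hP S)).ext (IsDiagonal.zero.congr fun i => ?_)
      split_ifs <;> simp
    · refine ((hP S).mul hG).ext (IsDiagonal.zero.congr fun i => ?_)
      split_ifs <;> simp
    · refine (hP S).norm_le zero_le_one fun i => ?_
      split_ifs <;> simp
    · refine (hQ S).norm_le zero_le_one fun i => ?_
      split_ifs <;> simp
    · refine ((hAc c).mul (hP S)).norm_le hα fun i => ?_
      split_ifs with h
      · simpa [← Complex.ofReal_sub] using h1 _ (hen i) h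
      · simpa using hα
    · have := hG.norm_le (inv_nonneg.2 hβ.le) hGb
      calc β * ‖G‖ ≤ β * β⁻¹ := by gcongr
        _ = 1 := mul_inv_cancel₀ hβ.ne'
  · intro μ
    have hker : (A - (μ : ℂ) • 1) * P {μ} = 0 := by
      refine ((hAc μ).mul (hP {μ})).ext (IsDiagonal.zero.congr fun i => ?_)
      by_cases h : ev i = μ <;> simp [h]
    ext v
    refine Submodule.eq_starProjection_of_mem_orthogonal ?_ ?_ |>.symm
    · exact congrArg (fun T : V →L[ℂ] V => T v) hker
    · rw [Submodule.mem_orthogonal]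
      intro w hw
      have hw0 : (A - (μ : ℂ) • 1) w = 0 := hw
      have hPw : P {μ} w = w := by
        apply b.repr.injective
        ext1
        funext i
        rw [hP]
        by_cases h : ev i = μ
        · simp [h]
        · have h1 := hAc μ w i
          rw [hw0, map_zero, lp.coeFn_zero, Pi.zero_apply, eq_comm, mul_eq_zero] at h1
          rcases h1 with h1 | h1
          · rw [Complex.ofReal_eq_zero] at h1
            exact absurd (sub_eq_zero.1 h1) h
          · rw [h1, mul_zero]
      have h1 : inner ℂ (P {μ} w) v = inner ℂ w (P {μ} v) :=
        (hP {μ}).isSelfAdjoint.isSymmetric w v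
      rw [inner_sub_right, ← h1, hPw, sub_self]

end Diagonal

/-! ### Stability of energies and norm continuity of spectral projections. -/

section Continuity

variable {V : Type*} [NormedAddCommGroup V] [InnerProductSpace ℂ V]

theorem AdiabaticEnv.exists_eigenvector {A : V →L[ℂ] V} {μ : ℝ} (h : μ ∈ energies A) :
    ∃ v, v ≠ 0 ∧ A v = (μ : ℂ) • v := by
  obtain ⟨v, hv⟩ := Module.End.HasEigenvalue.exists_hasEigenvector h
  exact ⟨v, hv.2, Module.End.mem_eigenspace_iff.1 hv.1⟩

theorem AdiabaticEnv.abs_energy_le {A : V →L[ℂ] V} {μ : ℝ} (h : μ ∈ energies A) : |μ| ≤ ‖A‖ := by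
  obtain ⟨v, hv, hA⟩ := exists_eigenvector h
  have h1 := A.le_opNorm v
  rw [hA, norm_smul, Complex.norm_real, Real.norm_eq_abs] at h1
  exact le_of_mul_le_mul_right h1 (norm_pos_iff.2 hv)

/-- An energy of `A'` at distance at least `ρ` from the spectrum of `A` forces
`‖A' - A‖ ≥ ρ`. -/
theorem AdiabaticEnv.le_norm_sub_of_left_inverse {A A' G : V →L[ℂ] V} {μ ρ : ℝ} (hρ : 0 < ρ)
    (hG : G * (A - (μ : ℂ) • 1) = 1) (hGn : ρ * ‖G‖ ≤ 1) (hμ : μ ∈ energies A') :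
    ρ ≤ ‖A' - A‖ := by
  obtain ⟨v, hv, hA⟩ := exists_eigenvector hμ
  have h1 : v = G (-((A' - A) v)) := by
    have h2 : (G * (A - (μ : ℂ) • 1)) v = v := by rw [hG]; rfl
    have h3 : -((A' - A) v) = A v - (μ : ℂ) • v := by
      rw [← hA, _root_.sub_apply, neg_sub]
    rw [h3]
    exact h2.symm
  have h4 : ‖v‖ ≤ ‖G‖ * (‖A' - A‖ * ‖v‖) := by
    calc ‖v‖ = ‖G (-((A' - A) v))‖ := by rw [← h1]
      _ ≤ ‖G‖ * ‖-((A' - A) v)‖ := G.le_opNorm _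
      _ ≤ _ := by
        rw [norm_neg]
        gcongr
        exact ContinuousLinearMap.le_opNorm _ _
  have hv' : 0 < ‖v‖ := norm_pos_iff.2 hv
  have h5 : 1 ≤ ‖G‖ * ‖A' - A‖ := by
    rw [← mul_assoc] at h4
    by_contra hc
    push Not at hc
    nlinarith
  calc ρ ≤ ρ * (‖G‖ * ‖A' - A‖) := by nlinarith
    _ = (ρ * ‖G‖) * ‖A' - A‖ := by ring
    _ ≤ 1 * ‖A' - A‖ := by gcongr
    _ = _ := one_mul _

theorem IsSpectralMeasure.le_norm_sub [CompleteSpace V] {A A' : V →L[ℂ] V}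
    {P : Set ℝ → V →L[ℂ] V} (h : IsSpectralMeasure A P) {μ ρ : ℝ} (hρ : 0 < ρ)
    (hd : ∀ ν ∈ energies A, ρ ≤ |ν - μ|) (hμ : μ ∈ energies A') : ρ ≤ ‖A' - A‖ := by
  obtain ⟨G, hG⟩ := h.split ∅ μ 0 ρ le_rfl hρ (fun _ _ h => h.elim) fun ν hν _ => hd ν hν
  refine le_norm_sub_of_left_inverse hρ ?_ hG.norm_inv hμ
  rw [hG.left_inv, h.empty, sub_zero]

/-- `Q` is injective on the range of `P`: a vector `v` there with `Q v = 0` is fixed by `(1 - Q) P`,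
a strict contraction. -/
theorem finrank_range_le_of_norm_lt_one {P Q : V →L[ℂ] V} (hP : P * P = P)
    [FiniteDimensional ℂ (LinearMap.range (Q : V →ₗ[ℂ] V))] (h : ‖(1 - Q) * P‖ < 1) :
    FiniteDimensional ℂ (LinearMap.range (P : V →ₗ[ℂ] V)) ∧
      Module.finrank ℂ (LinearMap.range (P : V →ₗ[ℂ] V))
        ≤ Module.finrank ℂ (LinearMap.range (Q : V →ₗ[ℂ] V)) := by
  let L : LinearMap.range (P : V →ₗ[ℂ] V) →ₗ[ℂ] LinearMap.range (Q : V →ₗ[ℂ] V) :=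
    (Q : V →ₗ[ℂ] V).rangeRestrict.comp (LinearMap.range (P : V →ₗ[ℂ] V)).subtype
  have hL : Function.Injective L := by
    rw [injective_iff_map_eq_zero]
    rintro ⟨v, u, hu⟩ hv
    have hQv : Q v = 0 := congrArg Subtype.val hv
    have hPv : P v = v := by
      rw [← hu]
      exact congrArg (fun T : V →L[ℂ] V => T u) hP
    have e : ((1 - Q) * P) v = v := by
      change (1 - Q) (P v) = v
      rw [hPv]
      change v - Q v = v
      rw [hQv, sub_zero]
    have h1 := ((1 - Q) * P).le_opNorm v
    rw [e] at h1
    have : v = 0 := by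
      by_contra h0
      have : 0 < ‖v‖ := norm_pos_iff.2 h0
      nlinarith
    exact Subtype.ext this
  exact ⟨FiniteDimensional.of_injective L hL, LinearMap.finrank_le_finrank_of_injective hL⟩

theorem eq_of_mul_eq_of_finrank_eq {P Q : V →L[ℂ] V} (hP : P * P = P) (h₁ : P * Q = P)
    (h₂ : Q * P = P) [FiniteDimensional ℂ (LinearMap.range (Q : V →ₗ[ℂ] V))]
    (hr : Module.finrank ℂ (LinearMap.range (P : V →ₗ[ℂ] V))
      = Module.finrank ℂ (LinearMap.range (Q : V →ₗ[ℂ] V))) : P = Q := by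
  have hle : LinearMap.range (P : V →ₗ[ℂ] V) ≤ LinearMap.range (Q : V →ₗ[ℂ] V) := by
    rintro _ ⟨u, rfl⟩
    exact ⟨P u, congrArg (fun T : V →L[ℂ] V => T u) h₂⟩
  have heq := Submodule.eq_of_le_of_finrank_eq hle hr
  have : P * Q = Q := by
    ext v
    have hv : Q v ∈ LinearMap.range (P : V →ₗ[ℂ] V) := by
      rw [heq]
      exact ⟨v, rfl⟩
    obtain ⟨u, hu⟩ := hv
    change P (Q v) = Q v
    rw [← hu]
    exact congrArg (fun T : V →L[ℂ] V => T u) hP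
  rw [← this, h₁]

theorem norm_sub_le_of_idempotents {R : Type*} [NormedRing R] (P Q : R) :
    ‖Q - P‖ ≤ ‖(1 - P) * Q‖ + ‖P * (1 - Q)‖ := by
  have : Q - P = (1 - P) * Q - P * (1 - Q) := by noncomm_ring
  rw [this]
  exact norm_sub_le _ _

/-- The projection onto the energies below a cutoff `m s` is norm continuous if it has constant
finite rank and, at each `s`, no energies lie near the cutoff. -/
theorem continuousOn_spectralProjection [CompleteSpace V] {A : ℝ → V →L[ℂ] V}
    {P : ℝ → Set ℝ → V →L[ℂ] V} {I : Set ℝ} {m : ℝ → ℝ} {n : ℕ}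
    (hP : ∀ s ∈ I, IsSpectralMeasure (A s) (P s)) (hA : ContinuousOn A I)
    (hgap : ∀ s ∈ I, ∃ a b, a < b ∧ ∀ μ ∈ energies (A s),
      (μ ≤ m s → μ ≤ a) ∧ (m s < μ → b ≤ μ))
    (hfin : ∀ s ∈ I, FiniteDimensional ℂ (LinearMap.range (P s (Iic (m s)) : V →ₗ[ℂ] V)))
    (hrank : ∀ s ∈ I, Module.finrank ℂ (LinearMap.range (P s (Iic (m s)) : V →ₗ[ℂ] V)) = n) :
    ContinuousOn (fun s => P s (Iic (m s))) I := by
  intro s hs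
  obtain ⟨a, b, hab, hm⟩ := hgap s hs
  -- Shifting by `K` makes the energies of `A s` and of all nearby `A t` nonnegative, so that
  -- distances from `-K` order them as on the line.
  set K := ‖A s‖ + 1 + |a| with hK
  have ha : 0 ≤ a + K := by linarith [neg_abs_le a, norm_nonneg (A s)]
  obtain ⟨Gs, hGs⟩ := (hP s hs).split (Iic (m s)) (-K) (a + K) (b + K) ha (by linarith)
    (fun μ hμ h => by
      rw [abs_of_nonneg (by linarith [neg_abs_le μ, abs_energy_le hμ, abs_nonneg a])]
      linarith [(hm μ hμ).1 h])
    (fun μ hμ h => by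
      rw [abs_of_nonneg (by linarith [neg_abs_le μ, abs_energy_le hμ, abs_nonneg a])]
      linarith [(hm μ hμ).2 (not_le.1 h)])
  have hclose : ∀ t ∈ I, ‖A t - A s‖ < 1 → ‖A t - A s‖ < (b - a) / 8 →
      ‖P t (Iic (m t)) - P s (Iic (m s))‖ ≤ 4 / (b - a) * ‖A t - A s‖ := by
    intro t ht h1 h8
    set δ := ‖A t - A s‖ with hδ
    have hδ0 : 0 ≤ δ := norm_nonneg _
    have hAt : ‖A t‖ ≤ ‖A s‖ + 1 := by
      have := norm_sub_norm_le (A t) (A s)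
      linarith
    have hen : ∀ μ ∈ energies (A t), μ ≤ a + δ ∨ b - δ ≤ μ := by
      intro μ hμ
      by_contra hc
      push Not at hc
      obtain ⟨h2, h3⟩ := hc
      have hρ : 0 < min (μ - a) (b - μ) := lt_min (by linarith) (by linarith)
      have h4 := (hP s hs).le_norm_sub hρ (fun ν hν => ?_) hμ
      · have := lt_min (show δ < μ - a by linarith) (show δ < b - μ by linarith)
        linarith
      · rcases le_or_gt ν (m s) with h5 | h5
        · exact (min_le_left _ _).trans (by linarith [(hm ν hν).1 h5, neg_abs_le (ν - μ)])
        · exact (min_le_right _ _).trans (by linarith [(hm ν hν).2 h5, le_abs_self (ν - μ)])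
    -- The cutoff `m` is not assumed continuous, so the projections at `t` and `s` are first
    -- compared using a fixed cutoff in the gap at `s`.
    set m' := (a + b) / 2 with hm'
    obtain ⟨Gt, hGt⟩ := (hP t ht).split (Iic m') (-K) (a + δ + K) (b - δ + K) (by linarith)
      (by linarith)
      (fun μ hμ h => by
        rw [abs_of_nonneg (by linarith [neg_abs_le μ, abs_energy_le hμ, abs_nonneg a])]
        have h' : μ ≤ m' := h
        rcases hen μ hμ with h2 | h2 <;> linarith)
      (fun μ hμ h => by
        rw [abs_of_nonneg (by linarith [neg_abs_le μ, abs_energy_le hμ, abs_nonneg a])]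
        have h' : m' < μ := not_le.1 h
        rcases hen μ hμ with h2 | h2 <;> linarith)
    set c : ℂ := ((-K : ℝ) : ℂ)
    have hst : ‖(A s - c • 1) - (A t - c • 1)‖ = δ := by
      rw [sub_sub_sub_cancel_right, norm_sub_rev]
    have hts : ‖(A t - c • 1) - (A s - c • 1)‖ = δ := by
      rw [sub_sub_sub_cancel_right]
    have d1 := hGs.norm_compl_mul_proj_le hGt
    have d2 := hGs.norm_proj_mul_compl_le hGt
    have d3 := hGt.norm_compl_mul_proj_le hGs
    rw [hst] at d1 d2
    rw [hts] at d3
    have aux : ∀ x : ℝ, 0 ≤ x → ∀ k, 7 / 8 * (b - a) ≤ k → k * x ≤ δ →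
        x ≤ 2 / (b - a) * δ := by
      intro x hx k hk hkx
      rw [div_mul_eq_mul_div, le_div_iff₀ (by linarith)]
      nlinarith
    have lt1 : 2 / (b - a) * δ < 1 := by
      rw [div_mul_eq_mul_div, div_lt_one (by linarith)]
      linarith
    have e1 := aux _ (norm_nonneg _) _ (by linarith) d1
    have e2 := aux _ (norm_nonneg _) _ (by linarith) d2
    have e3 := aux _ (norm_nonneg _) _ (by linarith) d3
    have := hfin s hs
    have := hfin t ht
    obtain ⟨f1, r1⟩ := finrank_range_le_of_norm_lt_one hGt.idem (e1.trans_lt lt1)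
    obtain ⟨-, r2⟩ := finrank_range_le_of_norm_lt_one hGs.idem (e3.trans_lt lt1)
    have hr : Module.finrank ℂ (LinearMap.range (P t (Iic m') : V →ₗ[ℂ] V))
        = Module.finrank ℂ (LinearMap.range (P t (Iic (m t)) : V →ₗ[ℂ] V)) := by
      rw [hrank t ht, ← hrank s hs]
      exact le_antisymm r1 r2
    have hidem : P t (Iic (m t)) * P t (Iic (m t)) = P t (Iic (m t)) := by
      rw [(hP t ht).mul, inter_self]
    -- The two projections at `t` belong to nested sets of energies and have the same finite rank,
    -- so they agree.
    have hPt : P t (Iic (m t)) = P t (Iic m') := by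
      rcases le_total (m t) m' with h2 | h2
      · refine eq_of_mul_eq_of_finrank_eq hidem ?_ ?_ hr.symm
        · rw [(hP t ht).mul, Iic_inter_Iic, inf_eq_left.2 h2]
        · rw [(hP t ht).mul, Iic_inter_Iic, inf_eq_right.2 h2]
      · refine (eq_of_mul_eq_of_finrank_eq hGt.idem ?_ ?_ hr).symm
        · rw [(hP t ht).mul, Iic_inter_Iic, inf_eq_left.2 h2]
        · rw [(hP t ht).mul, Iic_inter_Iic, inf_eq_right.2 h2]
    rw [hPt]
    refine (norm_sub_le_of_idempotents _ _).trans ((add_le_add e1 e2).trans_eq ?_)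
    ring
  have hδ : Tendsto (fun t => ‖A t - A s‖) (𝓝[I] s) (𝓝 0) := by
    simpa using ((hA s hs).tendsto.sub_const (A s)).norm
  have hev : ∀ᶠ t in 𝓝[I] s, ‖P t (Iic (m t)) - P s (Iic (m s))‖
      ≤ 4 / (b - a) * ‖A t - A s‖ := by
    have h8 : (0 : ℝ) < (b - a) / 8 := by linarith
    filter_upwards [self_mem_nhdsWithin, hδ.eventually_lt_const one_pos,
      hδ.eventually_lt_const h8] with t ht h1 h2 using hclose t ht h1 h2
  rw [ContinuousWithinAt, tendsto_iff_norm_sub_tendsto_zero]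
  refine squeeze_zero' (Eventually.of_forall fun t => norm_nonneg _) hev ?_
  simpa using hδ.const_mul (4 / (b - a))

end Continuity

/-! ### Ground state projections and the environment Hamiltonian. -/

section GroundState

variable {E F : Type*} [NormedAddCommGroup E] [InnerProductSpace ℂ E]
  [NormedAddCommGroup F] [InnerProductSpace ℂ F]

section Ground

variable [CompleteSpace E] {H : E →L[ℂ] E} {γ : ℝ} {P : Set ℝ → E →L[ℂ] E}

theorem IsSpectralMeasure.groundProj_eq (hP : IsSpectralMeasure H P) :
    P {groundEnergy H} = groundProj H := hP.singleton _

theorem IsSpectralMeasure.groundProj_split (hP : IsSpectralMeasure H P) (hH : HasGroundGap H γ)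
    {c : ℝ} (hγ : 0 < γ) (hc : c ≤ groundEnergy H) :
    ∃ G, SpectralSplit (H - (c : ℂ) • 1) (groundProj H) G (groundEnergy H - c)
      (groundEnergy H + γ - c) := by
  rw [← hP.groundProj_eq]
  refine hP.split _ _ _ _ (by linarith) (by linarith) ?_ ?_
  · rintro μ - rfl
    rw [abs_of_nonneg (by linarith)]
  · intro μ hμ hne
    have := hH.gap μ hμ hne
    rw [abs_of_nonneg (by linarith)]
    linarith

theorem finrank_range_groundProj (hH : HasGroundGap H γ) :
    FiniteDimensional ℂ (LinearMap.range (groundProj H : E →ₗ[ℂ] E)) ∧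
      Module.finrank ℂ (LinearMap.range (groundProj H : E →ₗ[ℂ] E)) = 1 := by
  have e : LinearMap.range (groundProj H : E →ₗ[ℂ] E)
      = Module.End.eigenspace (H : E →ₗ[ℂ] E) (groundEnergy H : ℂ) := by
    have h1 : LinearMap.range (groundProj H : E →ₗ[ℂ] E)
        = (H - (groundEnergy H : ℂ) • ContinuousLinearMap.id ℂ E).ker :=
      Submodule.range_starProjection _
    rw [h1]
    ext x
    rw [Module.End.mem_eigenspace_iff, LinearMap.mem_ker]
    change H x - (groundEnergy H : ℂ) • x = 0 ↔ H x = (groundEnergy H : ℂ) • x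
    exact sub_eq_zero
  rw [e]
  exact ⟨Module.finite_of_finrank_eq_succ hH.nondegenerate, hH.nondegenerate⟩

end Ground

section Environment

variable [FiniteDimensional ℂ F] {Henv : F →L[ℂ] F}

theorem isHamiltonian_of_finiteDimensional (h : (Henv : F →ₗ[ℂ] F).IsSymmetric) :
    IsHamiltonian Henv := by
  have : CompleteSpace F := FiniteDimensional.complete ℂ F
  refine ⟨h, Fin (Module.finrank ℂ F), inferInstance, (h.eigenvectorBasis rfl).toHilbertBasis,
    fun i => ⟨h.eigenvalues rfl i, ?_⟩⟩
  rw [OrthonormalBasis.coe_toHilbertBasis]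
  exact h.apply_eigenvectorBasis rfl i

theorem norm_sub_half_le (h : (Henv : F →ₗ[ℂ] F).IsSymmetric) (h0 : IsLeast (energies Henv) 0) :
    ‖Henv - ((‖Henv‖ / 2 : ℝ) : ℂ) • 1‖ ≤ ‖Henv‖ / 2 := by
  have : CompleteSpace F := FiniteDimensional.complete ℂ F
  obtain ⟨P, hP⟩ := (isHamiltonian_of_finiteDimensional h).exists_spectralMeasure
  -- No energy lies outside `univ`, so the lower bound 1 is arbitrary. Energies in `[0, ‖Henv‖]` are
  -- within `‖Henv‖ / 2` of the midpoint.
  obtain ⟨G, hG⟩ := hP.split univ (‖Henv‖ / 2) (‖Henv‖ / 2) 1 (by positivity) one_pos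
    (fun μ hμ _ => by
      have h1 := h0.2 hμ
      have h2 := (le_abs_self μ).trans (abs_energy_le hμ)
      rw [abs_le]
      constructor <;> linarith)
    (fun _ _ hn => absurd (mem_univ _) hn)
  simpa only [hP.univ, mul_one] using hG.norm_mul_proj

end Environment

theorem norm_real_smul {V : Type*} [SeminormedAddCommGroup V] [NormedSpace ℂ V] {r : ℝ}
    (hr : 0 ≤ r) (x : V) : ‖(r : ℂ) • x‖ = r * ‖x‖ := by
  rw [norm_smul, Complex.norm_real, Real.norm_of_nonneg hr]

end GroundState

/-! ### The low band of the composite Hamiltonian. -/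

section Coupling

variable {E V : Type*} [NormedAddCommGroup E] [InnerProductSpace ℂ E] [CompleteSpace E]
  [NormedAddCommGroup V] [InnerProductSpace ℂ V] [CompleteSpace V]

/-- `φ` represents the operators on the system `E` as operators on the composite space `V`, and `N`
is the Hamiltonian of an environment of dimension `n` with energies in `[0, h]`. -/
structure IsCoupling (φ : (E →L[ℂ] E) → (V →L[ℂ] V)) (N : V →L[ℂ] V) (h : ℝ) (n : ℕ) : Prop where
  map_one : φ 1 = 1
  map_mul : ∀ S T, φ (S * T) = φ S * φ T
  map_sub : ∀ S T, φ (S - T) = φ S - φ T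
  map_smul : ∀ (c : ℂ) T, φ (c • T) = c • φ T
  norm_le : ∀ T, ‖φ T‖ ≤ ‖T‖
  le_norm : ∀ T, ‖T‖ ≤ ‖φ T‖
  map_selfAdjoint : ∀ T, IsSelfAdjoint T → IsSelfAdjoint (φ T)
  selfAdjoint : IsSelfAdjoint N
  comm : ∀ T, Commute N (φ T)
  nonneg : 0 ≤ h
  norm_sub_half_le : ‖N - ((h / 2 : ℝ) : ℂ) • 1‖ ≤ h / 2
  rank : ∀ P : E →L[ℂ] E, P * P = P →
    Module.finrank ℂ (LinearMap.range (P : E →ₗ[ℂ] E)) = 1 →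
    FiniteDimensional ℂ (LinearMap.range (φ P : V →ₗ[ℂ] V)) ∧
      Module.finrank ℂ (LinearMap.range (φ P : V →ₗ[ℂ] V)) = n

variable {φ : (E →L[ℂ] E) → (V →L[ℂ] V)} {N : V →L[ℂ] V} {h : ℝ} {n : ℕ}
  {H : E →L[ℂ] E} {D : V →L[ℂ] V} {γ : ℝ} {P : Set ℝ → V →L[ℂ] V}

namespace IsCoupling

theorem sub_smul_one (hφ : IsCoupling φ N h n) (c : ℝ) :
    φ H + N + D - ((c + h / 2 : ℝ) : ℂ) • 1
      = φ (H - (c : ℂ) • 1) + (N - ((h / 2 : ℝ) : ℂ) • 1) + D := by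
  rw [hφ.map_sub, hφ.map_smul, hφ.map_one]
  push_cast
  module

theorem split_map (hφ : IsCoupling φ N h n) {B Q G : E →L[ℂ] E} {α β : ℝ}
    (s : SpectralSplit B Q G α β) : SpectralSplit (φ B) (φ Q) (φ G) α β :=
  s.map hφ.map_one hφ.map_mul hφ.map_sub hφ.norm_le

theorem energies (hφ : IsCoupling φ N h n) (hH : IsHamiltonian H) (hγ : HasGroundGap H γ)
    {μ : ℝ} (hμ : μ ∈ energies (φ H + N + D)) :
    groundEnergy H - ‖D‖ ≤ μ ∧ (μ ≤ groundEnergy H + h + ‖D‖ ∨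
      groundEnergy H + γ - ‖D‖ ≤ μ) := by
  obtain ⟨P, hP⟩ := hH.exists_spectralMeasure
  have hh0 := hφ.nonneg
  have hd0 := norm_nonneg D
  -- Up to the scalar `h / 2` the composite differs from `φ H` by an operator of norm at most `h / 2
  -- + ‖D‖`, so `μ - h / 2` cannot be farther than this from the energies of `H`. Centring the
  -- environment makes the band spread by `h` and not by `2h`.
  have key : ∀ ρ : ℝ, h / 2 + ‖D‖ < ρ →
      ¬ ∀ ν ∈ AdiabaticEnv.energies H, ρ ≤ |ν - (μ - h / 2)| := by
    intro ρ hρ hν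
    have hρ0 : 0 < ρ := by linarith
    obtain ⟨G, hG⟩ := hP.split ∅ (μ - h / 2) 0 ρ le_rfl hρ0 (fun _ _ h => h.elim)
      fun ν hν' _ => hν ν hν'
    have s := hφ.split_map hG
    have e2 := hφ.sub_smul_one (H := H) (D := D) (μ - h / 2)
    rw [sub_add_cancel] at e2
    set B := φ (H - ((μ - h / 2 : ℝ) : ℂ) • 1)
    have h1 := le_norm_sub_of_left_inverse (A := B + (μ : ℂ) • 1) (G := φ G) hρ0
      (by
        have h0 : φ 0 = 0 := by rw [← sub_self (0 : E →L[ℂ] E), hφ.map_sub, sub_self]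
        rw [add_sub_cancel_right, s.left_inv, hP.empty, h0, sub_zero]) s.norm_inv hμ
    have e3 : φ H + N + D - (B + (μ : ℂ) • 1) = (N - ((h / 2 : ℝ) : ℂ) • 1) + D := by
      rw [add_comm B, ← sub_sub, e2]
      abel
    rw [e3] at h1
    linarith [norm_add_le (N - ((h / 2 : ℝ) : ℂ) • 1) D, hφ.norm_sub_half_le]
  constructor
  · by_contra hc
    push Not at hc
    refine key (groundEnergy H - (μ - h / 2)) (by linarith) fun ν hν => ?_
    have := hγ.isLeast.2 hν
    exact le_trans (by linarith) (le_abs_self _)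
  · by_contra hc
    push Not at hc
    refine key (min ((μ - h / 2) - groundEnergy H) (groundEnergy H + γ - (μ - h / 2)))
      (lt_min (by linarith) (by linarith)) fun ν hν => ?_
    by_cases h0 : ν = groundEnergy H
    · rw [h0]
      exact (min_le_left _ _).trans (by linarith [neg_abs_le (groundEnergy H - (μ - h / 2))])
    · have := hγ.gap ν hν h0
      exact (min_le_right _ _).trans (by linarith [le_abs_self (ν - (μ - h / 2))])

/-- The cutoff `groundEnergy H + (h + γ) / 2` separates the low band from the other energies. -/
theorem energies_of_cutoff (hφ : IsCoupling φ N h n) (hH : IsHamiltonian H)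
    (hγ : HasGroundGap H γ) (hgap : h + 2 * ‖D‖ < γ) {μ : ℝ}
    (hμ : μ ∈ AdiabaticEnv.energies (φ H + N + D)) :
    groundEnergy H - ‖D‖ ≤ μ ∧
      (μ ≤ groundEnergy H + (h + γ) / 2 → μ ≤ groundEnergy H + h + ‖D‖) ∧
      (groundEnergy H + (h + γ) / 2 < μ → groundEnergy H + γ - ‖D‖ ≤ μ) := by
  obtain ⟨h1, h2⟩ := hφ.energies hH hγ hμ
  refine ⟨h1, fun h3 => ?_, fun h3 => ?_⟩ <;> rcases h2 with h2 | h2 <;> linarith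

/-- The centre `E₀ + h / 2` matches the centred environment, as needed for comparison with the
uncoupled ground projection. The cutoff is the midpoint of the gap and does not depend on `D`. -/
theorem lowBand_split (hφ : IsCoupling φ N h n) (hP : IsSpectralMeasure (φ H + N + D) P)
    (hH : IsHamiltonian H) (hγ : HasGroundGap H γ) (hgap : h + 2 * ‖D‖ < γ) :
    ∃ G, SpectralSplit (φ H + N + D - ((groundEnergy H + h / 2 : ℝ) : ℂ) • 1)
      (P (Iic (groundEnergy H + (h + γ) / 2))) G (h / 2 + ‖D‖) (γ - h / 2 - ‖D‖) := by
  have hh := hφ.nonneg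
  have hd := norm_nonneg D
  refine hP.split _ _ _ _ (by linarith) (by linarith) (fun μ hμ hle => ?_) (fun μ hμ hle => ?_)
  · obtain ⟨h1, h2, -⟩ := hφ.energies_of_cutoff hH hγ hgap hμ
    have h3 := h2 hle
    rw [abs_le]
    constructor <;> linarith
  · obtain ⟨-, -, h2⟩ := hφ.energies_of_cutoff hH hγ hgap hμ
    have h3 := h2 (not_le.1 hle)
    exact le_trans (by linarith) (le_abs_self _)

/-- Measured from a point below all energies, `β - α` is the true gap `γ - h - 2‖D‖`. Such a point
can be chosen independently of time, so that the shift does not affect derivatives. -/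
theorem lowBand_split_of_le (hφ : IsCoupling φ N h n) (hP : IsSpectralMeasure (φ H + N + D) P)
    (hH : IsHamiltonian H) (hγ : HasGroundGap H γ) (hgap : h + 2 * ‖D‖ < γ) {c : ℝ}
    (hc : c ≤ groundEnergy H) (hc' : c ≤ -‖φ H + N + D‖) :
    ∃ G, SpectralSplit (φ H + N + D - (c : ℂ) • 1) (P (Iic (groundEnergy H + (h + γ) / 2))) G
      (groundEnergy H + h + ‖D‖ - c) (groundEnergy H + γ - ‖D‖ - c) := by
  have hh := hφ.nonneg
  have hd := norm_nonneg D
  have habs : ∀ μ ∈ AdiabaticEnv.energies (φ H + N + D), |μ - c| = μ - c := by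
    intro μ hμ
    have := abs_energy_le hμ
    exact abs_of_nonneg (by linarith [neg_abs_le μ])
  refine hP.split _ _ _ _ (by linarith) (by linarith) (fun μ hμ hle => ?_) (fun μ hμ hle => ?_)
  · obtain ⟨h1, h2, -⟩ := hφ.energies_of_cutoff hH hγ hgap hμ
    have h3 := h2 hle
    rw [habs μ hμ]
    linarith
  · obtain ⟨-, -, h2⟩ := hφ.energies_of_cutoff hH hγ hgap hμ
    have h3 := h2 (not_le.1 hle)
    rw [habs μ hμ]
    linarith

theorem groundProj_split (hφ : IsCoupling φ N h n) (hH : IsHamiltonian H) (hγ : HasGroundGap H γ)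
    {c : ℝ} (hγ0 : 0 < γ) (hc : c ≤ groundEnergy H) :
    ∃ G, SpectralSplit (φ (H - (c : ℂ) • 1)) (φ (groundProj H)) G
      (groundEnergy H - c) (groundEnergy H + γ - c) := by
  obtain ⟨p, hp⟩ := hH.exists_spectralMeasure
  obtain ⟨G, hG⟩ := hp.groundProj_split hγ hγ0 hc
  exact ⟨φ G, hφ.split_map hG⟩

end IsCoupling

/-- Compression of a perturbation `N + D` of which `N` commutes with one of the two projections. -/
theorem norm_compress_le {R : Type*} [NormedRing R] {Q P N D X : R} {r d : ℝ}
    (hQ : ‖Q‖ ≤ 1) (hP : ‖P‖ ≤ 1) (hX : X = Q * P) (hN : ‖N‖ ≤ r) (hD : ‖D‖ ≤ d)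
    (hcomm : Commute N Q ∨ Commute N P) : ‖Q * (N + D) * P‖ ≤ r * ‖X‖ + d := by
  have h1 : ‖Q * D * P‖ ≤ d := (norm_mul_mul_le_of_contraction D hQ hP).trans hD
  have h2 : ‖Q * N * P‖ ≤ r * ‖X‖ := by
    rcases hcomm with h | h
    · rw [← h.eq, mul_assoc, ← hX]
      exact (norm_mul_le _ _).trans (by gcongr)
    · rw [mul_assoc, h.eq, ← mul_assoc, ← hX, mul_comm r]
      exact (norm_mul_le _ _).trans (by gcongr)
  calc ‖Q * (N + D) * P‖ = ‖Q * N * P + Q * D * P‖ := by congr 1; noncomm_ring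
    _ ≤ _ := (norm_add_le _ _).trans (add_le_add h2 h1)

/-- Since `N` commutes with `P₀`, it can be moved past it; its contribution to the Davis-Kahan
estimate is at most `r` times the quantity being estimated and is absorbed on the left. -/
theorem SpectralSplit.norm_compl_mul_proj_perturbed_le {R : Type*} [NormedRing R]
    {B P G B₀ P₀ G₀ N D : R} {α β α₀ β₀ r d : ℝ} (s : SpectralSplit B P G α β)
    (s₀ : SpectralSplit B₀ P₀ G₀ α₀ β₀) (e : B = B₀ + N + D) (hN : ‖N‖ ≤ r) (hD : ‖D‖ ≤ d)
    (hc : Commute N P₀) :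
    (β₀ - α - r) * ‖(1 - P₀) * P‖ ≤ d ∧ (β - α₀ - r) * ‖(1 - P) * P₀‖ ≤ d := by
  have eB : B - B₀ = N + D := by rw [e]; abel
  constructor
  · have h1 := s₀.norm_compl_mul_mul_proj_le s 1
    rw [mul_one, mul_one, one_mul, ← neg_sub B B₀, eB, mul_neg, neg_mul, norm_neg] at h1
    have h2 := norm_compress_le s₀.norm_compl s.norm_proj rfl hN hD
      (Or.inl ((Commute.one_right N).sub_right hc))
    linarith [h1.trans h2]
  · have h1 := s.norm_compl_mul_mul_proj_le s₀ 1
    rw [mul_one, mul_one, one_mul, eB] at h1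
    have h2 := norm_compress_le s.norm_compl s₀.norm_proj rfl hN hD (Or.inr hc)
    linarith [h1.trans h2]

namespace IsCoupling

theorem norm_excited_mul_lowBand_le (hφ : IsCoupling φ N h n)
    (hP : IsSpectralMeasure (φ H + N + D) P) (hH : IsHamiltonian H) (hγ : HasGroundGap H γ)
    (hgap : h + 2 * ‖D‖ < γ) :
    ‖(1 - φ (groundProj H)) * P (Iic (groundEnergy H + (h + γ) / 2))‖ ≤ ‖D‖ / (γ - h - ‖D‖) ∧
      ‖(1 - P (Iic (groundEnergy H + (h + γ) / 2))) * φ (groundProj H)‖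
        ≤ ‖D‖ / (γ - h - ‖D‖) := by
  have hh := hφ.nonneg
  have hd := norm_nonneg D
  obtain ⟨G₀, s₀⟩ := hφ.groundProj_split hH hγ (by linarith) le_rfl
  obtain ⟨G, s⟩ := hφ.lowBand_split hP hH hγ hgap
  obtain ⟨h1, h2⟩ := s.norm_compl_mul_proj_perturbed_le s₀ (hφ.sub_smul_one (groundEnergy H))
    hφ.norm_sub_half_le le_rfl
    ((hφ.comm _).sub_left ((Commute.one_left _).smul_left _))
  have hpos : 0 < γ - h - ‖D‖ := by linarith
  rw [le_div_iff₀ hpos, le_div_iff₀ hpos]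
  exact ⟨by linarith, by linarith⟩

/-- The condition `h + 2‖D‖ < γ` makes both Davis-Kahan bounds less than one, so each projection is
injective on the range of the other. -/
theorem finrank_range_lowBand (hφ : IsCoupling φ N h n)
    (hP : IsSpectralMeasure (φ H + N + D) P) (hH : IsHamiltonian H) (hγ : HasGroundGap H γ)
    (hgap : h + 2 * ‖D‖ < γ) :
    FiniteDimensional ℂ (LinearMap.range
        (P (Iic (groundEnergy H + (h + γ) / 2)) : V →ₗ[ℂ] V)) ∧
      Module.finrank ℂ (LinearMap.range
        (P (Iic (groundEnergy H + (h + γ) / 2)) : V →ₗ[ℂ] V)) = n := by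
  have hd := norm_nonneg D
  obtain ⟨n1, n2⟩ := hφ.norm_excited_mul_lowBand_le hP hH hγ hgap
  have hlt : ‖D‖ / (γ - h - ‖D‖) < 1 := by
    rw [div_lt_one (by linarith)]
    linarith
  obtain ⟨G, s⟩ := hφ.lowBand_split hP hH hγ hgap
  obtain ⟨p, hp⟩ := hH.exists_spectralMeasure
  have hidem : groundProj H * groundProj H = groundProj H := by
    rw [← hp.groundProj_eq, hp.mul, inter_self]
  obtain ⟨f0, r0⟩ := hφ.rank _ hidem (finrank_range_groundProj hγ).2
  obtain ⟨f1, r1⟩ := finrank_range_le_of_norm_lt_one s.idem (n1.trans_lt hlt)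
  obtain ⟨-, r2⟩ := finrank_range_le_of_norm_lt_one
    (show φ (groundProj H) * φ (groundProj H) = φ (groundProj H) by rw [← hφ.map_mul, hidem])
    (n2.trans_lt hlt)
  exact ⟨f1, by omega⟩

end IsCoupling

end Coupling

/-! ### The adiabatic theorem for coupled and uncoupled composites. -/

section AbstractAdiabatic

variable {E V : Type*} [NormedAddCommGroup E] [InnerProductSpace ℂ E] [CompleteSpace E]
  [NormedAddCommGroup V] [InnerProductSpace ℂ V] [CompleteSpace V]
  {φ : (E →L[ℂ] E) → (V →L[ℂ] V)} {N : V →L[ℂ] V} {h : ℝ} {n : ℕ}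
  {H : ℝ → E →L[ℂ] E} {A D U : ℝ → V →L[ℂ] V} {γ w τ b₁ b₂ : ℝ}

theorem AdiabaticEnv.IsHamiltonian.isSelfAdjoint {T : E →L[ℂ] E} (hT : IsHamiltonian T) :
    IsSelfAdjoint T :=
  ContinuousLinearMap.isSelfAdjoint_iff_isSymmetric.2 hT.symmetric

theorem isSelfAdjoint_real_smul_one (c : ℝ) : IsSelfAdjoint ((c : ℂ) • (1 : E →L[ℂ] E)) := by
  rw [isSelfAdjoint_iff, star_smul, star_one]
  simp

/-- A transition amplitude between the projections `p` from one between nearby projections `P`. -/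
theorem norm_transition_le_of_lowBand {R : Type*} [NormedRing R] {p₀ p₁ P₀ P₁ U : R}
    {C δ₀ δ₁ : ℝ} (hp₀ : ‖p₀‖ ≤ 1) (hp₁ : ‖1 - p₁‖ ≤ 1) (hP₀ : ‖P₀‖ ≤ 1) (hU : ‖U‖ ≤ 1)
    (hC : ‖(1 - P₁) * U * P₀‖ ≤ C) (h₁ : ‖(1 - p₁) * P₁‖ ≤ δ₁) (h₀ : ‖(1 - P₀) * p₀‖ ≤ δ₀)
    (hQ₁ : ‖1 - P₁‖ ≤ 1) :
    ‖(1 - p₁) * U * p₀‖ ≤ C + δ₀ + δ₁ + δ₀ * δ₁ := by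
  -- Insert `(1 - P₁) + P₁` before `U` and `P₀ + (1 - P₀)` after it; the four terms are bounded by
  -- `C`, `δ₀`, `δ₁` and `δ₀δ₁`.
  have e : (1 - p₁) * U * p₀ = (1 - p₁) * ((1 - P₁) * U * P₀) * p₀
      + (1 - p₁) * ((1 - P₁) * U) * ((1 - P₀) * p₀) + ((1 - p₁) * P₁) * (U * P₀) * p₀
      + ((1 - p₁) * P₁) * U * ((1 - P₀) * p₀) := by noncomm_ring
  have hδ₁ : 0 ≤ δ₁ := (norm_nonneg _).trans h₁
  have mul_le : ∀ {u v : R} {r t : ℝ}, ‖u‖ ≤ r → ‖v‖ ≤ t → ‖u * v‖ ≤ r * t := by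
    intro u v r t hu hv
    exact (norm_mul_le _ _).trans
      (mul_le_mul hu hv (norm_nonneg _) ((norm_nonneg _).trans hu))
  have n1 := mul_le (mul_le hp₁ hC) hp₀
  have n2 := mul_le (mul_le hp₁ (mul_le hQ₁ hU)) h₀
  have n3 := mul_le (mul_le h₁ (mul_le hU hP₀)) hp₀
  have n4 := mul_le (mul_le h₁ hU) h₀
  rw [e]
  have m1 := norm_add_le ((1 - p₁) * ((1 - P₁) * U * P₀) * p₀
      + (1 - p₁) * ((1 - P₁) * U) * ((1 - P₀) * p₀) + ((1 - p₁) * P₁) * (U * P₀) * p₀)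
      (((1 - p₁) * P₁) * U * ((1 - P₀) * p₀))
  have m2 := norm_add_le ((1 - p₁) * ((1 - P₁) * U * P₀) * p₀
      + (1 - p₁) * ((1 - P₁) * U) * ((1 - P₀) * p₀)) (((1 - p₁) * P₁) * (U * P₀) * p₀)
  have m3 := norm_add_le ((1 - p₁) * ((1 - P₁) * U * P₀) * p₀)
      ((1 - p₁) * ((1 - P₁) * U) * ((1 - P₀) * p₀))
  nlinarith

namespace IsCoupling

theorem norm_environment_le (hφ : IsCoupling φ N h n) : ‖N‖ ≤ h := by
  have h1 : ‖((h / 2 : ℝ) : ℂ) • (1 : V →L[ℂ] V)‖ ≤ h / 2 := by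
    rw [norm_real_smul (by linarith [hφ.nonneg])]
    exact mul_le_of_le_one_right (by linarith [hφ.nonneg]) ContinuousLinearMap.norm_id_le
  have h2 := norm_add_le (N - ((h / 2 : ℝ) : ℂ) • 1) (((h / 2 : ℝ) : ℂ) • (1 : V →L[ℂ] V))
  rw [sub_add_cancel] at h2
  linarith [hφ.norm_sub_half_le]

/-- A common lower bound for the ground energies and the composite Hamiltonians. -/
theorem exists_lower_bound (hφ : IsCoupling φ N h n)
    (hAeq : ∀ s ∈ Icc (0 : ℝ) 1, A s = φ (H s) + N + D s) (hA : ContinuousOn A (Icc 0 1))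
    (hγ : ∀ s ∈ Icc (0 : ℝ) 1, HasGroundGap (H s) γ)
    (hw : ∀ s ∈ Icc (0 : ℝ) 1, h + 2 * ‖D s‖ ≤ w) :
    ∃ c : ℝ, ∀ s ∈ Icc (0 : ℝ) 1, c ≤ groundEnergy (H s) ∧ c ≤ -‖A s‖ := by
  obtain ⟨C, hC⟩ := isCompact_Icc.exists_bound_of_continuousOn hA
  -- The ground energy is bounded in size by `‖φ (H s)‖ = ‖A s - N - D s‖ ≤ C + h + ‖D s‖ ≤ C + w`.
  refine ⟨-(C + w), fun s hs => ?_⟩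
  have h0 := hφ.nonneg
  have hd := norm_nonneg (D s)
  have h1 := hw s hs
  have h2 := hC s hs
  have h3 := abs_energy_le (hγ s hs).isLeast.1
  have h4 := hφ.le_norm (H s)
  have h5 : φ (H s) = A s - N - D s := by rw [hAeq s hs]; abel
  have h6 := norm_sub_le (A s - N) (D s)
  have h7 := norm_sub_le (A s) N
  rw [← h5] at h6
  have h8 := hφ.norm_environment_le
  constructor <;> linarith [neg_abs_le (groundEnergy (H s))]

theorem isGappedFamily_lowBand (hφ : IsCoupling φ N h n)
    (hAeq : ∀ s ∈ Icc (0 : ℝ) 1, A s = φ (H s) + N + D s) (hA : ContinuousOn A (Icc 0 1))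
    (hAH : ∀ s ∈ Icc (0 : ℝ) 1, IsHamiltonian (A s))
    (hH : ∀ s ∈ Icc (0 : ℝ) 1, IsHamiltonian (H s))
    (hγ : ∀ s ∈ Icc (0 : ℝ) 1, HasGroundGap (H s) γ)
    (hw : ∀ s ∈ Icc (0 : ℝ) 1, h + 2 * ‖D s‖ ≤ w) (hwγ : w < γ)
    {P : ℝ → Set ℝ → V →L[ℂ] V} (hP : ∀ s ∈ Icc (0 : ℝ) 1, IsSpectralMeasure (A s) (P s)) :
    ∃ c : ℝ, IsGappedFamily (fun s => A s - (c : ℂ) • 1)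
      (fun s => P s (Iic (groundEnergy (H s) + (h + γ) / 2))) (γ - w) := by
  obtain ⟨c, hc⟩ := hφ.exists_lower_bound hAeq hA hγ hw
  have hgap : ∀ s ∈ Icc (0 : ℝ) 1, h + 2 * ‖D s‖ < γ := fun s hs => (hw s hs).trans_lt hwγ
  have hP' : ∀ s ∈ Icc (0 : ℝ) 1, IsSpectralMeasure (φ (H s) + N + D s) (P s) := fun s hs => by
    rw [← hAeq s hs]
    exact hP s hs
  refine ⟨c, ⟨fun s hs => ?_, fun s hs => ?_, fun s hs => (hP s hs).selfAdjoint _, ?_⟩⟩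
  · have h1 := hc s hs
    rw [hAeq s hs] at h1 ⊢
    obtain ⟨G, hG⟩ := hφ.lowBand_split_of_le (hP' s hs) (hH s hs) (hγ s hs) (hgap s hs) h1.1 h1.2
    exact ⟨G, _, _, hG, by linarith [hw s hs]⟩
  · exact (hAH s hs).isSelfAdjoint.sub (isSelfAdjoint_real_smul_one c)
  · refine continuousOn_spectralProjection (n := n) hP hA (fun s hs => ?_)
      (fun s hs => (hφ.finrank_range_lowBand (hP' s hs) (hH s hs) (hγ s hs) (hgap s hs)).1)
      (fun s hs => (hφ.finrank_range_lowBand (hP' s hs) (hH s hs) (hγ s hs) (hgap s hs)).2)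
    refine ⟨groundEnergy (H s) + h + ‖D s‖, groundEnergy (H s) + γ - ‖D s‖,
      by linarith [hgap s hs], fun μ hμ => ?_⟩
    rw [hAeq s hs] at hμ
    exact (hφ.energies_of_cutoff (hH s hs) (hγ s hs) (hgap s hs) hμ).2

theorem norm_transition_le (hφ : IsCoupling φ N h n)
    (hAeq : ∀ s ∈ Icc (0 : ℝ) 1, A s = φ (H s) + N + D s) (hA : IsAdiabaticEvolution A)
    (hH : ∀ s ∈ Icc (0 : ℝ) 1, IsHamiltonian (H s))
    (hγ : ∀ s ∈ Icc (0 : ℝ) 1, HasGroundGap (H s) γ)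
    (hw : ∀ s ∈ Icc (0 : ℝ) 1, h + 2 * ‖D s‖ ≤ w) (hwγ : w < γ) (hτ : 0 < τ)
    (hU : IsEvolution τ A U) (hb₁ : ∀ s ∈ Icc (0 : ℝ) 1, ‖deriv1 A s‖ ≤ b₁)
    (hb₂ : ∀ s ∈ Icc (0 : ℝ) 1, ‖deriv2 A s‖ ≤ b₂) :
    ‖(1 - φ (groundProj (H 1))) * U 1 * φ (groundProj (H 0))‖
      ≤ (4 * b₁ + 2 * b₂ + 24 * b₁ ^ 2 / (γ - w)) / (τ * (γ - w) ^ 2)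
        + ‖D 0‖ / (γ - h - ‖D 0‖) + ‖D 1‖ / (γ - h - ‖D 1‖)
        + ‖D 0‖ / (γ - h - ‖D 0‖) * (‖D 1‖ / (γ - h - ‖D 1‖)) := by
  have hAc : ContinuousOn A (Icc 0 1) := hA.differentiable.continuousOn
  have hex : ∀ s, ∃ P : Set ℝ → V →L[ℂ] V, s ∈ Icc (0 : ℝ) 1 → IsSpectralMeasure (A s) P := by
    intro s
    by_cases hs : s ∈ Icc (0 : ℝ) 1
    · obtain ⟨P, hP⟩ := (hA.hamiltonian s hs).exists_spectralMeasure
      exact ⟨P, fun _ => hP⟩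
    · exact ⟨fun _ => 0, fun h => absurd h hs⟩
  choose P hP using hex
  obtain ⟨c, hc⟩ := hφ.isGappedFamily_lowBand hAeq hAc hA.hamiltonian hH hγ hw hwγ hP
  have m0 : (0 : ℝ) ∈ Icc (0 : ℝ) 1 := left_mem_Icc.2 zero_le_one
  have m1 : (1 : ℝ) ∈ Icc (0 : ℝ) 1 := right_mem_Icc.2 zero_le_one
  have hcore := hc.norm_transition_le (b := deriv1 A) (b' := deriv2 A) (U := U)
    (N := (c : ℂ) • 1) (by linarith) hτ
    (fun s hs => (hA.differentiable s hs).hasDerivWithinAt.sub_const _)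
    (fun s hs => (hA.differentiable_deriv s hs).hasDerivWithinAt) hb₁ hb₂
    (isSelfAdjoint_real_smul_one c) (fun s _ => (Commute.one_left _).smul_left _)
    (fun s _ => (Commute.one_left _).smul_left _) hU.initial
    (fun s hs => by
      rw [sub_add_cancel]
      exact hU.schrodinger s hs)
  have hgap : ∀ s ∈ Icc (0 : ℝ) 1, h + 2 * ‖D s‖ < γ := fun s hs => (hw s hs).trans_lt hwγ
  have hP' : ∀ s ∈ Icc (0 : ℝ) 1, IsSpectralMeasure (φ (H s) + N + D s) (P s) := fun s hs => by
    rw [← hAeq s hs]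
    exact hP s hs
  have hγ0 : 0 < γ := by linarith [hφ.nonneg, hgap 0 m0, norm_nonneg (D 0)]
  have hUn : ‖U 1‖ ≤ 1 := norm_le_one_of_star_mul_self
    (evolution_star_mul_self (fun s hs => (hA.hamiltonian s hs).isSelfAdjoint) hU.initial
      hU.schrodinger 1 m1)
  obtain ⟨_, g0⟩ := hφ.groundProj_split (hH 0 m0) (hγ 0 m0) hγ0 le_rfl
  obtain ⟨_, g1⟩ := hφ.groundProj_split (hH 1 m1) (hγ 1 m1) hγ0 le_rfl
  obtain ⟨_, l0⟩ := hφ.lowBand_split (hP' 0 m0) (hH 0 m0) (hγ 0 m0) (hgap 0 m0)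
  obtain ⟨_, l1⟩ := hφ.lowBand_split (hP' 1 m1) (hH 1 m1) (hγ 1 m1) (hgap 1 m1)
  exact norm_transition_le_of_lowBand g0.norm_proj g1.norm_compl l0.norm_proj hUn hcore
    (hφ.norm_excited_mul_lowBand_le (hP' 1 m1) (hH 1 m1) (hγ 1 m1) (hgap 1 m1)).1
    (hφ.norm_excited_mul_lowBand_le (hP' 0 m0) (hH 0 m0) (hγ 0 m0) (hgap 0 m0)).2 l1.norm_compl

/-- Without coupling the environment only contributes a commuting factor, and the gap is that of
the system. -/
theorem norm_transition_le_uncoupled (hφ : IsCoupling φ N h n)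
    (hAeq : ∀ s ∈ Icc (0 : ℝ) 1, A s = φ (H s) + N) (hA : IsAdiabaticEvolution A)
    (hH : ∀ s ∈ Icc (0 : ℝ) 1, IsHamiltonian (H s))
    (hγ : ∀ s ∈ Icc (0 : ℝ) 1, HasGroundGap (H s) γ) (hγ0 : 0 < γ) (hτ : 0 < τ)
    (hU : IsEvolution τ A U) (hb₁ : ∀ s ∈ Icc (0 : ℝ) 1, ‖deriv1 A s‖ ≤ b₁)
    (hb₂ : ∀ s ∈ Icc (0 : ℝ) 1, ‖deriv2 A s‖ ≤ b₂) :
    ‖(1 - φ (groundProj (H 1))) * U 1 * φ (groundProj (H 0))‖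
      ≤ (4 * b₁ + 2 * b₂ + 24 * b₁ ^ 2 / γ) / (τ * γ ^ 2) := by
  have hAc : ContinuousOn A (Icc 0 1) := hA.differentiable.continuousOn
  have hsub : ∀ S T, ‖S - T‖ ≤ ‖φ S - φ T‖ := fun S T => by
    rw [← hφ.map_sub]
    exact hφ.le_norm _
  have hsub' : ∀ S T, ‖φ S - φ T‖ ≤ ‖S - T‖ := fun S T => by
    rw [← hφ.map_sub]
    exact hφ.norm_le _
  -- `H` itself is not assumed continuous; as `φ` is isometric and `N` is constant, continuity is
  -- inherited from `A`.
  have hHc : ContinuousOn H (Icc 0 1) := by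
    intro s hs
    rw [ContinuousWithinAt, tendsto_iff_norm_sub_tendsto_zero]
    have h1 := tendsto_iff_norm_sub_tendsto_zero.1 (hAc s hs)
    refine squeeze_zero' (Eventually.of_forall fun t => norm_nonneg _) ?_ h1
    filter_upwards [self_mem_nhdsWithin] with t ht
    refine (hsub _ _).trans_eq ?_
    rw [hAeq t ht, hAeq s hs, add_sub_add_right_eq_sub]
  have hex : ∀ s, ∃ P : Set ℝ → E →L[ℂ] E, s ∈ Icc (0 : ℝ) 1 → IsSpectralMeasure (H s) P := by
    intro s
    by_cases hs : s ∈ Icc (0 : ℝ) 1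
    · obtain ⟨P, hP⟩ := (hH s hs).exists_spectralMeasure
      exact ⟨P, fun _ => hP⟩
    · exact ⟨fun _ => 0, fun h => absurd h hs⟩
  choose P hP using hex
  have hcut : ∀ s ∈ Icc (0 : ℝ) 1, ∀ μ ∈ AdiabaticEnv.energies (H s),
      (μ ≤ groundEnergy (H s) + γ / 2 → μ ≤ groundEnergy (H s)) ∧
      (groundEnergy (H s) + γ / 2 < μ → groundEnergy (H s) + γ ≤ μ) := by
    intro s hs μ hμ
    by_cases h0 : μ = groundEnergy (H s)
    · rw [h0]
      exact ⟨fun _ => le_rfl, fun h => by linarith⟩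
    · have := (hγ s hs).gap μ hμ h0
      exact ⟨fun h => by linarith, fun h => by linarith⟩
  have hground : ∀ s ∈ Icc (0 : ℝ) 1,
      P s (Iic (groundEnergy (H s) + γ / 2)) = groundProj (H s) := by
    intro s hs
    rw [← (hP s hs).groundProj_eq]
    refine (hP s hs).congr _ _ fun μ hμ => ⟨fun h => ?_, fun h => ?_⟩
    · exact le_antisymm ((hcut s hs μ hμ).1 h) ((hγ s hs).isLeast.2 hμ)
    · have h' : μ = groundEnergy (H s) := h
      rw [mem_Iic, h']
      linarith
  have hPc : ContinuousOn (fun s => groundProj (H s)) (Icc 0 1) := by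
    refine (continuousOn_spectralProjection (n := 1) hP hHc
      (fun s hs => ⟨_, _, by linarith, hcut s hs⟩) (fun s hs => ?_) (fun s hs => ?_)).congr
      fun s hs => (hground s hs).symm
    · rw [hground s hs]
      exact (finrank_range_groundProj (hγ s hs)).1
    · rw [hground s hs]
      exact (finrank_range_groundProj (hγ s hs)).2
  obtain ⟨c, hc⟩ := hφ.exists_lower_bound (D := fun _ => 0) (w := h)
    (fun s hs => by rw [hAeq s hs, add_zero]) hAc hγ (fun s _ => by simp)
  have hgapped : IsGappedFamily (fun s => φ (H s - (c : ℂ) • 1))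
      (fun s => φ (groundProj (H s))) γ := by
    refine ⟨fun s hs => ?_, fun s hs => ?_, fun s hs => ?_, fun s hs => ?_⟩
    · obtain ⟨G, hG⟩ := hφ.groundProj_split (hH s hs) (hγ s hs) hγ0 (hc s hs).1
      exact ⟨G, _, _, hG, by linarith⟩
    · exact hφ.map_selfAdjoint _ ((hH s hs).isSelfAdjoint.sub (isSelfAdjoint_real_smul_one c))
    · refine hφ.map_selfAdjoint _ ?_
      rw [← (hP s hs).groundProj_eq]
      exact (hP s hs).selfAdjoint _
    · rw [ContinuousWithinAt, tendsto_iff_norm_sub_tendsto_zero]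
      have h1 := tendsto_iff_norm_sub_tendsto_zero.1 (hPc s hs)
      exact squeeze_zero (fun t => norm_nonneg _) (fun t => hsub' _ _) h1
  have hsplit : ∀ s ∈ Icc (0 : ℝ) 1,
      φ (H s - (c : ℂ) • 1) = A s - (N + (c : ℂ) • 1) := by
    intro s hs
    rw [hφ.map_sub, hφ.map_smul, hφ.map_one, hAeq s hs]
    abel
  exact hgapped.norm_transition_le (b := deriv1 A) (b' := deriv2 A) (U := U)
    (N := N + (c : ℂ) • 1) hγ0 hτ
    (fun s hs => ((hA.differentiable s hs).hasDerivWithinAt.sub_const _).congr hsplit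
      (hsplit s hs))
    (fun s hs => (hA.differentiable_deriv s hs).hasDerivWithinAt) hb₁ hb₂
    (hφ.selfAdjoint.add (isSelfAdjoint_real_smul_one c))
    (fun s _ => (hφ.comm _).add_left ((Commute.one_left _).smul_left _))
    (fun s _ => (hφ.comm _).add_left ((Commute.one_left _).smul_left _)) hU.initial
    (fun s hs => by
      rw [hsplit s hs, sub_add_cancel]
      exact hU.schrodinger s hs)

end IsCoupling

end AbstractAdiabatic

/-! ### Realization of the coupling on the tensor product. -/

section Tensor

variable {E F : Type*} [NormedAddCommGroup E] [InnerProductSpace ℂ E]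
  [NormedAddCommGroup F] [InnerProductSpace ℂ F]

/-- A Hilbert basis is an isometry onto a complete `ℓ²` space. This supplies completeness of the
algebraic tensor product `E ⊗ F`. -/
theorem AdiabaticEnv.HasCountableEigenbasis.completeSpace {A : E →L[ℂ] E}
    (h : HasCountableEigenbasis A) : CompleteSpace E := by
  obtain ⟨ι, -, b, -⟩ := h
  exact (completeSpace_congr (e := b.repr.toEquiv) b.repr.isometry.isUniformEmbedding).2
    inferInstance

theorem norm_le_norm_mapL_id [Nontrivial F] (T : E →L[ℂ] E) :
    ‖T‖ ≤ ‖TensorProduct.mapL T (ContinuousLinearMap.id ℂ F)‖ := by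
  obtain ⟨f, hf⟩ := exists_ne (0 : F)
  refine T.opNorm_le_bound
    (norm_nonneg (TensorProduct.mapL T (ContinuousLinearMap.id ℂ F))) fun x => ?_
  have h := (TensorProduct.mapL T (ContinuousLinearMap.id ℂ F)).le_opNorm (x ⊗ₜ f)
  have e : TensorProduct.mapL T (ContinuousLinearMap.id ℂ F) (x ⊗ₜ f) = T x ⊗ₜ f :=
    TensorProduct.mapL_tmul ..
  rw [e, TensorProduct.norm_tmul, TensorProduct.norm_tmul, ← mul_assoc] at h
  exact le_of_mul_le_mul_right h (norm_pos_iff.2 hf)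

theorem norm_mapL_id_right_le (T : E →L[ℂ] E) :
    ‖TensorProduct.mapL T (ContinuousLinearMap.id ℂ F)‖ ≤ ‖T‖ := by
  refine (TensorProduct.norm_mapL_le _ _).trans ?_
  exact mul_le_of_le_one_right (norm_nonneg _) ContinuousLinearMap.norm_id_le

theorem norm_mapL_id_left_le (S : F →L[ℂ] F) :
    ‖TensorProduct.mapL (ContinuousLinearMap.id ℂ E) S‖ ≤ ‖S‖ := by
  refine (TensorProduct.norm_mapL_le _ _).trans ?_
  exact mul_le_of_le_one_left (norm_nonneg _) ContinuousLinearMap.norm_id_le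

theorem mapL_sub_left (S T : E →L[ℂ] E) (R : F →L[ℂ] F) :
    TensorProduct.mapL (S - T) R = TensorProduct.mapL S R - TensorProduct.mapL T R := by
  rw [eq_sub_iff_add_eq, ← TensorProduct.mapL_add_left, sub_add_cancel]

theorem mapL_sub_right (R : E →L[ℂ] E) (S T : F →L[ℂ] F) :
    TensorProduct.mapL R (S - T) = TensorProduct.mapL R S - TensorProduct.mapL R T := by
  rw [eq_sub_iff_add_eq, ← TensorProduct.mapL_add_right, sub_add_cancel]

theorem isSelfAdjoint_mapL [CompleteSpace E] [CompleteSpace F] [CompleteSpace (E ⊗[ℂ] F)]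
    {T : E →L[ℂ] E} {S : F →L[ℂ] F} (hT : IsSelfAdjoint T) (hS : IsSelfAdjoint S) :
    IsSelfAdjoint (TensorProduct.mapL T S) := by
  rw [ContinuousLinearMap.isSelfAdjoint_iff'] at *
  rw [TensorProduct.adjoint_mapL, hT, hS]

/-- `P ⊗ I` has rank `dim F` if `P` has rank one. -/
theorem finrank_range_mapL_id [FiniteDimensional ℂ F] {P : E →L[ℂ] E} (hP : P * P = P)
    (h : Module.finrank ℂ (LinearMap.range (P : E →ₗ[ℂ] E)) = 1) :
    FiniteDimensional ℂ (LinearMap.range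
        (TensorProduct.mapL P (ContinuousLinearMap.id ℂ F) : E ⊗[ℂ] F →ₗ[ℂ] E ⊗[ℂ] F)) ∧
      Module.finrank ℂ (LinearMap.range
        (TensorProduct.mapL P (ContinuousLinearMap.id ℂ F) : E ⊗[ℂ] F →ₗ[ℂ] E ⊗[ℂ] F))
        = Module.finrank ℂ F := by
  obtain ⟨⟨e, he⟩, he0, hspan⟩ := finrank_eq_one_iff'.1 h
  have he0' : e ≠ 0 := fun h0 => he0 (Subtype.ext h0)
  have hPe : P e = e := by
    obtain ⟨u, hu⟩ := he
    rw [← hu]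
    exact congrArg (fun T : E →L[ℂ] E => T u) hP
  have hinj : Function.Injective (TensorProduct.mk ℂ E F e) := by
    rw [injective_iff_map_eq_zero]
    intro f hf
    have h1 : ‖e ⊗ₜ[ℂ] f‖ = 0 := by rw [norm_eq_zero]; exact hf
    rw [TensorProduct.norm_tmul, mul_eq_zero] at h1
    rcases h1 with h1 | h1
    · exact absurd (norm_eq_zero.1 h1) he0'
    · exact norm_eq_zero.1 h1
  have hrange : LinearMap.range
      (TensorProduct.mapL P (ContinuousLinearMap.id ℂ F) : E ⊗[ℂ] F →ₗ[ℂ] E ⊗[ℂ] F)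
      = LinearMap.range (TensorProduct.mk ℂ E F e) := by
    apply le_antisymm
    · rintro _ ⟨z, rfl⟩
      induction z using TensorProduct.induction_on with
      | zero => simp
      | tmul x f =>
        obtain ⟨c, hc⟩ := hspan ⟨P x, x, rfl⟩
        have hc' : c • e = P x := congrArg Subtype.val hc
        refine ⟨c • f, ?_⟩
        change e ⊗ₜ[ℂ] (c • f) = P x ⊗ₜ[ℂ] f
        rw [← hc', TensorProduct.smul_tmul]
      | add y z hy hz =>
        rw [map_add]
        exact add_mem hy hz
    · rintro _ ⟨f, rfl⟩
      refine ⟨e ⊗ₜ f, ?_⟩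
      change P e ⊗ₜ[ℂ] f = e ⊗ₜ[ℂ] f
      rw [hPe]
  rw [hrange]
  exact ⟨inferInstance, LinearMap.finrank_range_of_inj hinj⟩

theorem isCoupling_mapL [CompleteSpace E] [FiniteDimensional ℂ F] [CompleteSpace (E ⊗[ℂ] F)]
    {Henv : F →L[ℂ] F} (hEnv : (Henv : F →ₗ[ℂ] F).IsSymmetric)
    (hEnv0 : IsLeast (energies Henv) 0) :
    IsCoupling (V := E ⊗[ℂ] F)
      (fun T : E →L[ℂ] E => TensorProduct.mapL T (ContinuousLinearMap.id ℂ F))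
      (TensorProduct.mapL (ContinuousLinearMap.id ℂ E) Henv) ‖Henv‖ (Module.finrank ℂ F) := by
  have hF : CompleteSpace F := FiniteDimensional.complete ℂ F
  have hnt : Nontrivial F := by
    obtain ⟨v, hv, -⟩ := exists_eigenvector hEnv0.1
    exact ⟨v, 0, hv⟩
  refine ⟨?_, fun S T => ?_, fun S T => ?_, fun c T => ?_, fun T => ?_, fun T => ?_, fun T hT => ?_,
    ?_, fun T => ?_, norm_nonneg _, ?_, fun P hP h1 => ?_⟩
  · exact TensorProduct.mapL_id_id
  · exact (TensorProduct.mapL_mul S T (ContinuousLinearMap.id ℂ F) (ContinuousLinearMap.id ℂ F))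
  · exact mapL_sub_left S T _
  · exact TensorProduct.mapL_smul_left ..
  · exact norm_mapL_id_right_le T
  · exact norm_le_norm_mapL_id T
  · exact isSelfAdjoint_mapL hT (IsSelfAdjoint.one _)
  · exact isSelfAdjoint_mapL (IsSelfAdjoint.one _)
      (ContinuousLinearMap.isSelfAdjoint_iff_isSymmetric.2 hEnv)
  · exact (TensorProduct.mapL_mul (ContinuousLinearMap.id ℂ E) T Henv
      (ContinuousLinearMap.id ℂ F)).symm.trans
      (TensorProduct.mapL_mul T (ContinuousLinearMap.id ℂ E) (ContinuousLinearMap.id ℂ F) Henv)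
  · have e : TensorProduct.mapL (ContinuousLinearMap.id ℂ E)
        (Henv - ((‖Henv‖ / 2 : ℝ) : ℂ) • 1)
        = TensorProduct.mapL (ContinuousLinearMap.id ℂ E) Henv
          - ((‖Henv‖ / 2 : ℝ) : ℂ) • 1 := by
      have e1 : TensorProduct.mapL (ContinuousLinearMap.id ℂ E) (1 : F →L[ℂ] F) = 1 :=
        TensorProduct.mapL_id_id
      rw [mapL_sub_right, TensorProduct.mapL_smul_right, e1]
    have h2 := (norm_mapL_id_left_le (E := E) _).trans (norm_sub_half_le hEnv hEnv0)
    rw [e] at h2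
    exact h2
  · exact finrank_range_mapL_id hP h1

end Tensor

/-! ### Passage to the stated constants and conclusion. -/

/-- Already for `D = 1` the right-hand side has `16 b₁ + 8 b₂ + 128 b₁² / g` in place of `4 b₁ + 2
b₂ + 24 b₁² / g`, and it increases with `D`. -/
theorem adiabatic_bound_le {τ g D b₁ b₂ : ℝ} (hτ : 0 < τ) (hg : 0 < g) (hD : 1 ≤ D)
    (hb₁ : 0 ≤ b₁) (hb₂ : 0 ≤ b₂) :
    (4 * b₁ + 2 * b₂ + 24 * b₁ ^ 2 / g) / (τ * g ^ 2)
      ≤ 8 * D ^ 2 / (τ * g ^ 2) * (2 * b₁ + b₂ + 8 * (1 + D) * b₁ ^ 2 / g) := by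
  rw [div_mul_eq_mul_div]
  gcongr
  have hx : 0 ≤ b₁ ^ 2 / g := by positivity
  have h1 : 24 * b₁ ^ 2 / g = 24 * (b₁ ^ 2 / g) := by ring
  have h2 : 8 * (1 + D) * b₁ ^ 2 / g = 8 * (1 + D) * (b₁ ^ 2 / g) := by ring
  rw [h1, h2]
  have h3 : 16 * (b₁ ^ 2 / g) ≤ 8 * (1 + D) * (b₁ ^ 2 / g) := by
    gcongr
    linarith
  have h4 : 8 * 1 * (2 * b₁ + b₂ + 8 * (1 + D) * (b₁ ^ 2 / g))
      ≤ 8 * D ^ 2 * (2 * b₁ + b₂ + 8 * (1 + D) * (b₁ ^ 2 / g)) := by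
    gcongr
    exact one_le_pow₀ hD
  linarith

theorem add_ofReal_zero_smul {V : Type*} [AddCommGroup V] [Module ℂ V] (x y : V) :
    x + ((0 : ℝ) : ℂ) • y = x := by
  simp

theorem mainTheorem4
    {E : Type*} [NormedAddCommGroup E] [InnerProductSpace ℂ E] [CompleteSpace E]
    {F : Type*} [NormedAddCommGroup F] [InnerProductSpace ℂ F] [FiniteDimensional ℂ F]
    (M : ℕ) (hM : Module.finrank ℂ F = M)
    (H : ℝ → E →L[ℂ] E) (Henv : F →L[ℂ] F) (Δ : ℝ → E ⊗[ℂ] F →L[ℂ] E ⊗[ℂ] F)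
    (U : ℝ → E ⊗[ℂ] F →L[ℂ] E ⊗[ℂ] F)
    (ε τ γ w b₁ b₂ : ℝ) (hε : 0 ≤ ε) (hτ : 0 < τ)
    (hH : ∀ s ∈ Icc (0 : ℝ) 1, IsHamiltonian (H s))
    (hγ : ∀ s ∈ Icc (0 : ℝ) 1, HasGroundGap (H s) γ)
    (hEnv : (Henv : F →ₗ[ℂ] F).IsSymmetric)
    (hEnv0 : IsLeast (energies Henv) 0)
    (hAT : IsAdiabaticEvolution fun s => compositeHamiltonian (H s) Henv ε (Δ s))
    (hU : IsEvolution τ (fun s => compositeHamiltonian (H s) Henv ε (Δ s)) U)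
    (hw : ∀ s ∈ Icc (0 : ℝ) 1, ‖Henv‖ + 2 * ε * ‖Δ s‖ ≤ w) (hwγ : w < γ)
    (hb₁ : ∀ s ∈ Icc (0 : ℝ) 1,
      ‖deriv1 (fun r => compositeHamiltonian (H r) Henv ε (Δ r)) s‖ ≤ b₁)
    (hb₂ : ∀ s ∈ Icc (0 : ℝ) 1,
      ‖deriv2 (fun r => compositeHamiltonian (H r) Henv ε (Δ r)) s‖ ≤ b₂) :
    ‖TensorProduct.mapL (excitedProj (H 1)) (ContinuousLinearMap.id ℂ F) ∘L U 1 ∘L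
        TensorProduct.mapL (groundProj (H 0)) (ContinuousLinearMap.id ℂ F)‖ ≤
      8 * widthFactor ε γ w ^ 2 / (τ * coupledGap ε γ w ^ 2) *
          (2 * b₁ + b₂ + 8 * (1 + widthFactor ε γ w) * b₁ ^ 2 / coupledGap ε γ w)
        + endpointError ε γ ‖Henv‖ ‖Δ 0‖ + endpointError ε γ ‖Henv‖ ‖Δ 1‖
        + endpointError ε γ ‖Henv‖ ‖Δ 0‖ * endpointError ε γ ‖Henv‖ ‖Δ 1‖ := by
  have m0 : (0 : ℝ) ∈ Icc (0 : ℝ) 1 := left_mem_Icc.2 zero_le_one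
  have hV : CompleteSpace (E ⊗[ℂ] F) := (hAT.hamiltonian 0 m0).eigenbasis.completeSpace
  have hφ := isCoupling_mapL (E := E) hEnv hEnv0
  have hb₁0 : 0 ≤ b₁ := (ContinuousLinearMap.opNorm_nonneg _).trans (hb₁ 0 m0)
  have hb₂0 : 0 ≤ b₂ := (ContinuousLinearMap.opNorm_nonneg _).trans (hb₂ 0 m0)
  have hw0 : 0 ≤ w := by
    have h1 : 0 ≤ 2 * ε * ‖Δ 0‖ := mul_nonneg (by linarith) (ContinuousLinearMap.opNorm_nonneg _)
    linarith [hw 0 m0, norm_nonneg Henv]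
  have hexc : TensorProduct.mapL (excitedProj (H 1)) (ContinuousLinearMap.id ℂ F)
      = 1 - TensorProduct.mapL (groundProj (H 1)) (ContinuousLinearMap.id ℂ F) := by
    rw [excitedProj, mapL_sub_left, TensorProduct.mapL_id_id]
    rfl
  rw [hexc]
  rcases hε.eq_or_lt with rfl | hε'
  · have hmain := hφ.norm_transition_le_uncoupled
      (fun s _ => add_ofReal_zero_smul _ (Δ s))
      hAT hH hγ (by linarith) hτ hU hb₁ hb₂
    have e1 : coupledGap 0 γ w = γ := if_neg (lt_irrefl _)
    have e2 : widthFactor 0 γ w = 1 := if_neg (lt_irrefl _)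
    have e3 : ∀ x y, endpointError 0 γ x y = 0 := fun x y => by simp [endpointError]
    rw [e1, e2, e3, e3, add_zero, add_zero, mul_zero, add_zero]
    exact hmain.trans (adiabatic_bound_le hτ (by linarith) le_rfl hb₁0 hb₂0)
  · have hD : ∀ s, ‖(ε : ℂ) • Δ s‖ = ε * ‖Δ s‖ := fun s => norm_real_smul hε (Δ s)
    have hmain := hφ.norm_transition_le (D := fun s => (ε : ℂ) • Δ s) (w := w) (fun s _ => rfl)
      hAT hH hγ (fun s hs => by
        rw [hD, ← mul_assoc]
        exact hw s hs) hwγ hτ hU hb₁ hb₂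
    simp only [hD] at hmain
    have e1 : coupledGap ε γ w = γ - w := if_pos hε'
    have e2 : widthFactor ε γ w = 1 + 2 * w / (Real.pi * coupledGap ε γ w) := if_pos hε'
    have e3 : 1 ≤ widthFactor ε γ w := by
      rw [e2, e1]
      have : 0 < γ - w := by linarith
      have : 0 ≤ 2 * w / (Real.pi * (γ - w)) := by positivity
      linarith
    rw [e1]
    refine hmain.trans ?_
    have := adiabatic_bound_le hτ (sub_pos.2 hwγ) e3 hb₁0 hb₂0
    unfold endpointError
    linarith
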